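/- Theorem (PTAS). Notation. For $n\ge 2$, $\mathbb S_n$ is the set of rankings of $[n]$, i.e. of permutations $\sigma=(\sigma_1,\dots,\sigma_n)$, where $\sigma_i$ is the candidate in position $i$ (position $1$ is the best); $c>_\sigma a$ means that $\sigma$ ranks $c$ above $a$, and $x^{\downarrow,\sigma}=\{y: x>_\sigma y\}$. For $S\subseteq[n]$ let $M(S,\sigma)$ be the set consisting of the $\sigma$-best element of $S$. For $\beta=(\beta_k)_{k\ge2}$ and a measure $\mu$ on $[n]$, put $$\mathrm d^\mu_\beta(\sigma,\pi)=\sum_{S\subseteq[n],\,|S|\ge2}\beta_{|S|}\,\mu\big(M(S,\sigma)\triangle M(S,\pi)\big),\qquad f_\beta(t)=\sum_{k=2}^n\beta_k\binom{t}{k-1},$$ $$\mathrm d^\mu_\beta(\sigma,\pi;b,t)=\sum_{i=b}^{t}\Big[f_\beta(n-i)\big(\mu(\sigma_i)+\mu(\pi_i)\big)-2f_\beta\big(|\sigma_i^{\downarrow,\sigma}\cap\sigma_i^{\downarrow,\pi}|\big)\mu(\sigma_i)\Big]$$ (an empty sum if $t<b$). For a profile $V=(v^1,\dots,v^m)\in\mathbb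 S_n^m$, $m\ge1$, put $\mathrm d^\mu_\beta(\sigma,V)=\sum_j\mathrm d^\mu_\beta(\sigma,v^j)$ and $\mathrm d^\mu_\beta(\sigma,V;b,t)=\sum_j\mathrm d^\mu_\beta(\sigma,v^j;b,t)$. Algorithm MyopicTop, with input $K\ge1$, $V$, $\beta\ge 0$ and $\mu\ge 0$: start with $Q=[n]$ and $i=1$. While some $c\in Q$ is preferred to all other elements of $Q$ by more than $m/2$ voters, set $\sigma_i=c$, remove $c$ from $Q$ and increase $i$ by $1$. Then replace $K$ by $\min\{K,|Q|\}$ and return any ranking $\sigma^{\mathrm{apx}}$ that minimises $\omega\mapsto\mathrm d^\mu_\beta(\omega,V;i,i+K-1)$ over the rankings $\omega$ with $\omega_k=\sigma_k$ for all $k<i$. Claim. There are a program $P$ for a random access machine with real arithmetic (unit cost for assignments of constants, array accesses, additions and subtractions of natural numbers, additions, subtractions and multiplications of real numbers, and comparisons) that implements Algorithm MyopicTop, i.e. on each input (with $n\ge2$, $m\ge1$) it halts with a possible output of the algorithm, and an absolute constant $C$ such that the following holds. Let $\beta_k\ge0$ for all $k\ge2$, $\beta_2>0$, and, writing $$h(K)=\sup_{t\ge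 \max(K,2)}\frac{\sum_{j=2}^{t-K}\beta_j\binom{t-K}{j}}{\sum_{j=0}^{t-2}\beta_{j+2}\binom{t-2}{j}}\in[0,\infty],$$ suppose that $\lim_{K\to\infty}h(K)=0$. For each $k\ge2$ let $\mu^{(k)}$ be a measure on $[k]$ with $0<u\le\mu^{(k)}_i\le U<\infty$ for all $i$ and $k$. For $\delta>0$ let $g(1/\delta)=\min\{K\ge1: h(K)\le\delta\}$. Fix $\epsilon>0$ and let $K=g\big(\tfrac{12U}{u\epsilon}\big)$; this minimum exists. Then for all $n\ge2$, $m\ge1$ and $V\in\mathbb S_n^m$: 1. every possible output $\sigma^{\mathrm{apx}}$ of Algorithm MyopicTop on the input $K$, $V$, $(\beta_k)_{k=2}^n$, $\mu^{(n)}$ satisfies $$\mathrm d^{\mu^{(n)}}_\beta(\sigma^{\mathrm{apx}},V)\le(1+\epsilon)\,\mathrm d^{\mu^{(n)}}_\beta(\sigma^*,V)$$ for every $\sigma^*$ that minimises $\mathrm d^{\mu^{(n)}}_\beta(\cdot,V)$ over $\mathbb S_n$; 2. on this input $P$ halts, with a possible output of Algorithm MyopicTop, after at most $C\,n^{K+1}mK$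 steps. -/

import Mathlib

open Filter Topology
open scoped ENNReal

namespace RankAgg

noncomputable section

/-! ## Rankings and top-difference distances

A ranking of `n` candidates is a permutation `σ` of `Fin n`; `σ p` is the candidate in
position `p` (position `0` is the most favoured one). -/

/-- `c >_σ a`: the ranking `σ` prefers the candidate `c` to the candidate `a`. -/
def Prefers {n : ℕ} (σ : Equiv.Perm (Fin n)) (c a : Fin n) : Prop :=
  σ.symm c < σ.symm a

instance {n : ℕ} (σ : Equiv.Perm (Fin n)) (c a : Fin n) : Decidable (Prefers σ c a) :=
  inferInstanceAs (Decidable (σ.symm c < σ.symm a))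

/-- The candidates to which `σ` prefers `x`. -/
def below {n : ℕ} (σ : Equiv.Perm (Fin n)) (x : Fin n) : Finset (Fin n) :=
  Finset.univ.filter fun y => Prefers σ x y

/-- `M(S, σ)`: the set of `σ`-maximal elements of the menu `S`. -/
def best {n : ℕ} (S : Finset (Fin n)) (σ : Equiv.Perm (Fin n)) : Finset (Fin n) :=
  S.filter fun x => ∀ y ∈ S, y ≠ x → Prefers σ x y

/-- The `(β, μ)`-top-difference distance: the sum, over all menus `S` with at least two elements,
of `β_{|S|} · μ(M(S,σ) ∆ M(S,π))`. Only the values `β 2, …, β n` matter. -/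
def topDist {n : ℕ} (β : ℕ → ℝ) (μ : Fin n → ℝ) (σ π : Equiv.Perm (Fin n)) : ℝ :=
  ∑ S ∈ (Finset.univ : Finset (Finset (Fin n))).filter (fun S => 2 ≤ S.card),
    β S.card * ∑ x ∈ symmDiff (best S σ) (best S π), μ x

/-- The cumulative distance of `σ` to the profile `V`. -/
def profileDist {n m : ℕ} (β : ℕ → ℝ) (μ : Fin n → ℝ) (σ : Equiv.Perm (Fin n))
    (V : Fin m → Equiv.Perm (Fin n)) : ℝ :=
  ∑ j, topDist β μ σ (V j)

/-- `σ` is a consensus (median) ranking of the profile `V`. -/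
def IsConsensus {n m : ℕ} (β : ℕ → ℝ) (μ : Fin n → ℝ) (V : Fin m → Equiv.Perm (Fin n))
    (σ : Equiv.Perm (Fin n)) : Prop :=
  ∀ π : Equiv.Perm (Fin n), profileDist β μ σ V ≤ profileDist β μ π V

/-- `f_β(t) = ∑_{k=2}^n β_k * binom(t, k-1)`. -/
def fBeta (n : ℕ) (β : ℕ → ℝ) (t : ℕ) : ℝ :=
  ∑ k ∈ Finset.Icc 2 n, β k * (t.choose (k - 1) : ℝ)

/-- The top-difference truncation to the positions `b, …, t`, where positions are numbered from `1`
(so `p : Fin n` is position `p + 1`). It is `0` if `t < b`. -/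
def truncDist {n : ℕ} (β : ℕ → ℝ) (μ : Fin n → ℝ) (σ π : Equiv.Perm (Fin n)) (b t : ℕ) : ℝ :=
  ∑ p ∈ (Finset.univ : Finset (Fin n)).filter (fun p : Fin n => b ≤ (p : ℕ) + 1 ∧ (p : ℕ) + 1 ≤ t),
    (fBeta n β (n - ((p : ℕ) + 1)) * (μ (σ p) + μ (π p))
      - 2 * fBeta n β (below σ (σ p) ∩ below π (σ p)).card * μ (σ p))

/-- The truncated distance of `σ` to the profile `V`. -/
def profileTruncDist {n m : ℕ} (β : ℕ → ℝ) (μ : Fin n → ℝ) (σ : Equiv.Perm (Fin n))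
    (V : Fin m → Equiv.Perm (Fin n)) (b t : ℕ) : ℝ :=
  ∑ j, truncDist β μ σ (V j) b t

/-! ## Algorithm MyopicTop -/

/-- `c ∈ Q`, and strictly more than half of the voters prefer `c` to every other element of `Q`. -/
def IsMajority {n m : ℕ} (V : Fin m → Equiv.Perm (Fin n)) (Q : Finset (Fin n)) (c : Fin n) : Prop :=
  c ∈ Q ∧ (m : ℝ) / 2 <
    ((Finset.univ.filter fun j : Fin m => ∀ a ∈ Q.erase c, Prefers (V j) c a).card : ℝ)

/-- The states that the while-loop reaches: the list of the candidates placed so far (best first)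
and the set `Q` of the remaining candidates. -/
inductive LoopReaches {n m : ℕ} (V : Fin m → Equiv.Perm (Fin n)) :
    List (Fin n) → Finset (Fin n) → Prop
  | start : LoopReaches V [] Finset.univ
  | step {l : List (Fin n)} {Q : Finset (Fin n)} {c : Fin n} :
      LoopReaches V l Q → IsMajority V Q c → LoopReaches V (l ++ [c]) (Q.erase c)

/-- The ranking `ω` starts with the list `l`. -/
def StartsWith {n : ℕ} (ω : Equiv.Perm (Fin n)) (l : List (Fin n)) : Prop :=
  ∀ (p : Fin n) (h : (p : ℕ) < l.length), ω p = l[(p : ℕ)]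

/-- `ω` is a possible output of Algorithm MyopicTop on the input `K, V, β, μ`: when the while-loop
stops, with candidates `l` placed and candidates `Q` remaining, `ω` minimises the distance to `V`
truncated to the positions `|l| + 1, …, |l| + min K |Q|` among all rankings that start with `l`. -/
def IsMyopicTopOutput {n m : ℕ} (K : ℕ) (V : Fin m → Equiv.Perm (Fin n)) (β : ℕ → ℝ)
    (μ : Fin n → ℝ) (ω : Equiv.Perm (Fin n)) : Prop :=
  ∃ (l : List (Fin n)) (Q : Finset (Fin n)),
    LoopReaches V l Q ∧ (¬ ∃ c, IsMajority V Q c) ∧ StartsWith ω l ∧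
    ∀ ω' : Equiv.Perm (Fin n), StartsWith ω' l →
      profileTruncDist β μ ω V (l.length + 1) (l.length + min K Q.card) ≤
        profileTruncDist β μ ω' V (l.length + 1) (l.length + min K Q.card)

/-! ## The growth rate and the truncation depth -/

/-- The supremum over `t ≥ max K 2` of
`(∑_{j=2}^{t-K} β_j binom(t-K, j)) / (∑_{j=0}^{t-2} β_{j+2} binom(t-2, j))`, in `[0, ∞]`
(the quotients are non-negative for non-negative weights). -/
def growthSup (β : ℕ → ℝ) (K : ℕ) : ℝ≥0∞ :=
  ⨆ (t : ℕ) (_ : max K 2 ≤ t), ENNReal.ofReal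
    ((∑ j ∈ Finset.Icc 2 (t - K), β j * ((t - K).choose j : ℝ)) /
      (∑ j ∈ Finset.Icc 0 (t - 2), β (j + 2) * ((t - 2).choose j : ℝ)))

/-- The truncation depths `K ≥ 1` that are admissible for the accuracy `δ`. -/
def depthSet (β : ℕ → ℝ) (δ : ℝ) : Set ℕ :=
  {K | 1 ≤ K ∧ growthSup β K ≤ ENNReal.ofReal δ}

/-- The function `g`, which sends `1/δ` to the least admissible depth for the accuracy `δ`. -/
def depth (β : ℕ → ℝ) (x : ℝ) : ℕ :=
  sInf (depthSet β (1 / x))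

end

end RankAgg

/-! ## A random access machine with real arithmetic

Programs have natural and real registers and natural and real arrays, all addressed by natural
numbers; an array cell is addressed through a natural register. Each elementary operation and each
evaluation of a test takes one step. There is no multiplication of natural numbers, and no
conversion of a real number to a natural number. -/

namespace RealRAM

noncomputable section

/-- The memory. `natArr A i` and `realArr A i` are the `i`-th cells of the arrays numbered `A`. -/
structure Store where
  nat : ℕ → ℕ
  real : ℕ → ℝ
  natArr : ℕ → ℕ → ℕ
  realArr : ℕ → ℕ → ℝ

/-- Elementary operations. The numbers `x, y, z` name registers and `A` names an array. -/
inductive Op where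
  /-- `x := c` -/
  | natConst (x c : ℕ)
  /-- `x := y + z` -/
  | natAdd (x y z : ℕ)
  /-- `x := y - z`, cut off at `0` -/
  | natSub (x y z : ℕ)
  /-- `x := A[y]` -/
  | natLoad (x A y : ℕ)
  /-- `A[x] := y` -/
  | natStore (A x y : ℕ)
  /-- `x := c`, for a real register `x` -/
  | realConst (x c : ℕ)
  /-- `x := y + z`, for real registers -/
  | realAdd (x y z : ℕ)
  /-- `x := y - z`, for real registers -/
  | realSub (x y z : ℕ)
  /-- `x := y * z`, for real registers -/
  | realMul (x y z : ℕ)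
  /-- `x := A[y]`, for a real register `x`, a real array `A` and a natural register `y` -/
  | realLoad (x A y : ℕ)
  /-- `A[x] := y`, for a real array `A`, a natural register `x` and a real register `y` -/
  | realStore (A x y : ℕ)

/-- The effect of an elementary operation. -/
def Op.apply : Op → Store → Store
  | .natConst x c, s => { s with nat := Function.update s.nat x c }
  | .natAdd x y z, s => { s with nat := Function.update s.nat x (s.nat y + s.nat z) }
  | .natSub x y z, s => { s with nat := Function.update s.nat x (s.nat y - s.nat z) }
  | .natLoad x A y, s => { s with nat := Function.update s.nat x (s.natArr A (s.nat y)) }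
  | .natStore A x y, s =>
      let row := Function.update (s.natArr A) (s.nat x) (s.nat y)
      { s with natArr := Function.update s.natArr A row }
  | .realConst x c, s => { s with real := Function.update s.real x (c : ℝ) }
  | .realAdd x y z, s => { s with real := Function.update s.real x (s.real y + s.real z) }
  | .realSub x y z, s => { s with real := Function.update s.real x (s.real y - s.real z) }
  | .realMul x y z, s => { s with real := Function.update s.real x (s.real y * s.real z) }
  | .realLoad x A y, s => { s with real := Function.update s.real x (s.realArr A (s.nat y)) }
  | .realStore A x y, s =>
      let row := Function.update (s.realArr A) (s.nat x) (s.real y)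
      { s with realArr := Function.update s.realArr A row }

/-- Tests: strict comparison of two registers. -/
inductive Test where
  | natLt (x y : ℕ)
  | realLt (x y : ℕ)

/-- The truth of a test. -/
def Test.Holds : Test → Store → Prop
  | .natLt x y, s => s.nat x < s.nat y
  | .realLt x y, s => s.real x < s.real y

/-- Programs. -/
inductive Program where
  | op (o : Op)
  | seq (P Q : Program)
  | ite (b : Test) (P Q : Program)
  | loop (b : Test) (P : Program)

/-- `Exec P s s' t`: started in the memory `s`, the program `P` halts in the memory `s'` after
exactly `t` steps. -/
inductive Exec : Program → Store → Store → ℕ → Prop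
  | op (o : Op) (s : Store) : Exec (.op o) s (o.apply s) 1
  | seq {P Q : Program} {s₀ s₁ s₂ : Store} {t₁ t₂ : ℕ} :
      Exec P s₀ s₁ t₁ → Exec Q s₁ s₂ t₂ → Exec (.seq P Q) s₀ s₂ (t₁ + t₂)
  | iteTrue {b : Test} {P Q : Program} {s₀ s₁ : Store} {t : ℕ} :
      b.Holds s₀ → Exec P s₀ s₁ t → Exec (.ite b P Q) s₀ s₁ (t + 1)
  | iteFalse {b : Test} {P Q : Program} {s₀ s₁ : Store} {t : ℕ} :
      ¬ b.Holds s₀ → Exec Q s₀ s₁ t → Exec (.ite b P Q) s₀ s₁ (t + 1)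
  | loopTrue {b : Test} {P : Program} {s₀ s₁ s₂ : Store} {t₁ t₂ : ℕ} :
      b.Holds s₀ → Exec P s₀ s₁ t₁ → Exec (.loop b P) s₁ s₂ t₂ →
        Exec (.loop b P) s₀ s₂ (t₁ + t₂ + 1)
  | loopFalse {b : Test} {P : Program} {s₀ : Store} :
      ¬ b.Holds s₀ → Exec (.loop b P) s₀ s₀ 1

/-- The memory that holds the input `K, V, β, μ` and is `0` elsewhere: the natural registers `0, 1, 2`
hold `n, m, K`; cell `j * n + p` of the natural array `0` holds the candidate in position `p` of
voter `j`; the real array `0` holds `β 2, …, β n` in the cells `2, …, n`; the real array `1`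
holds `μ`. -/
def inputStore {n m : ℕ} (K : ℕ) (V : Fin m → Equiv.Perm (Fin n)) (β : ℕ → ℝ)
    (μ : Fin n → ℝ) : Store where
  nat x := if x = 0 then n else if x = 1 then m else if x = 2 then K else 0
  real _ := 0
  natArr A i :=
    if A = 0 then
      if h : i / n < m ∧ i % n < n then (V ⟨i / n, h.1⟩ ⟨i % n, h.2⟩ : ℕ) else 0
    else 0
  realArr A i :=
    if A = 0 then (if 2 ≤ i ∧ i ≤ n then β i else 0)
    else if A = 1 then (if h : i < n then μ ⟨i, h⟩ else 0)
    else 0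

/-- The memory `s` holds the output `ω`: cell `p` of the natural array `1` holds the candidate in
position `p` of `ω`. -/
def HoldsOutput {n : ℕ} (s : Store) (ω : Equiv.Perm (Fin n)) : Prop :=
  ∀ p : Fin n, s.natArr 1 p = (ω p : ℕ)

/-- On the input `K, V, β, μ` the program `P` halts after exactly `t` steps and returns a ranking
that is a possible output of Algorithm MyopicTop on this input. -/
def RunsMyopicTop {n m : ℕ} (P : Program) (K : ℕ) (V : Fin m → Equiv.Perm (Fin n)) (β : ℕ → ℝ)
    (μ : Fin n → ℝ) (t : ℕ) : Prop :=
  ∃ (s : Store) (ω : Equiv.Perm (Fin n)),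
    Exec P (inputStore K V β μ) s t ∧ HoldsOutput s ω ∧ RankAgg.IsMyopicTopOutput K V β μ ω

/-- `P` implements Algorithm MyopicTop on all of its inputs. -/
def ImplementsMyopicTop (P : Program) : Prop :=
  ∀ (n m K : ℕ) (V : Fin m → Equiv.Perm (Fin n)) (β : ℕ → ℝ) (μ : Fin n → ℝ),
    2 ≤ n → 1 ≤ m → 1 ≤ K → (∀ k, 2 ≤ k → k ≤ n → 0 ≤ β k) → (∀ i, 0 ≤ μ i) →
      ∃ t : ℕ, RunsMyopicTop P K V β μ t

end

end RealRAM

open Filter Topology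
open scoped ENNReal

namespace RealRAM

/-! ## Verification of programs -/

/-! Guarantee. A candidate is chosen from a menu by two rankings at once exactly when the rest of
the menu lies below it in both. Summing over menus therefore turns the distance into contributions
of single positions (`topDist_eq_sum_posTerm`), each depending on the first ranking only up to that
position. The cost splits into a prefix placed by the while-loop, a window of at most `K` positions
that the output optimises, and a tail.

A candidate that more than half of the voters put first in `Q` is an optimal choice from every menu
inside `Q` that contains it (`IsMajority.menuCost_le`). Moving it to the front of `Q` by neighbour
exchanges never raises the cost, so some ranking `ω` has the prefix of the loop and costs no more
than a consensus (`LoopReaches.exists_startsWith_profileDist_le`). The output equals `ω` on the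
prefix and is no worse on the window. In the tail it loses at most `2 U m` times the weight of the
menus inside a set of `|Q| - K` candidates. Once the loop stops, the favourite in `Q` of any ranking
is rejected by at least half of the voters, and each of them disagrees on all menus inside `Q` that
contain both favourites (`le_profileDist_of_forall_not_isMajority`). The ratio of these two weights
is the quotient in `growthSup` at `t = |Q|`.

Program. A permutation is kept in an array, and majority winners are swapped to its front.
Continuations are enumerated by counting through strings of at most `K` digits in base `n`, each
digit naming a position to exchange with, and each continuation is evaluated from tables in `O(nmK)`
steps. `Run` carries the invariants with time bounds; `Frame` says what stays untouched. The machine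
lacks copying, idling and products of naturals: adding the zero in register `19` copies, overwriting
scratch register `11` idles, and running sums yield `j * n`. -/

/-- The operation writes the natural register `r`. -/
def Op.writesNat (r : ℕ) : Op → Bool
  | .natConst x _ => r == x
  | .natAdd x _ _ => r == x
  | .natSub x _ _ => r == x
  | .natLoad x _ _ => r == x
  | _ => false

/-- The operation writes the real register `r`. -/
def Op.writesReal (r : ℕ) : Op → Bool
  | .realConst x _ => r == x
  | .realAdd x _ _ => r == x
  | .realSub x _ _ => r == x
  | .realMul x _ _ => r == x
  | .realLoad x _ _ => r == x
  | _ => false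

/-- The operation writes the natural array `r`. -/
def Op.writesNatArr (r : ℕ) : Op → Bool
  | .natStore A _ _ => r == A
  | _ => false

/-- The operation writes the real array `r`. -/
def Op.writesRealArr (r : ℕ) : Op → Bool
  | .realStore A _ _ => r == A
  | _ => false

/-- Some operation of the program satisfies `f`. -/
def Program.anyOp (f : Op → Bool) : Program → Bool
  | .op o => f o
  | .seq P Q => P.anyOp f || Q.anyOp f
  | .ite _ P Q => P.anyOp f || Q.anyOp f
  | .loop _ P => P.anyOp f

/-- The stores `s` and `s'` agree on all that `P` does not write. -/
structure Frame (P : Program) (s s' : Store) : Prop where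
  nat : ∀ x, P.anyOp (Op.writesNat x) = false → s'.nat x = s.nat x
  real : ∀ x, P.anyOp (Op.writesReal x) = false → s'.real x = s.real x
  natArr : ∀ A, P.anyOp (Op.writesNatArr A) = false → s'.natArr A = s.natArr A
  realArr : ∀ A, P.anyOp (Op.writesRealArr A) = false → s'.realArr A = s.realArr A

theorem Frame.refl (P : Program) (s : Store) : Frame P s s :=
  ⟨fun _ _ => rfl, fun _ _ => rfl, fun _ _ => rfl, fun _ _ => rfl⟩

theorem Frame.trans {P : Program} {s₁ s₂ s₃ : Store} (h : Frame P s₁ s₂) (h' : Frame P s₂ s₃) :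
    Frame P s₁ s₃ :=
  ⟨fun x hx => (h'.nat x hx).trans (h.nat x hx), fun x hx => (h'.real x hx).trans (h.real x hx),
    fun x hx => (h'.natArr x hx).trans (h.natArr x hx),
    fun x hx => (h'.realArr x hx).trans (h.realArr x hx)⟩

theorem Frame.mono {P Q : Program} {s s' : Store}
    (hPQ : ∀ f : Op → Bool, Q.anyOp f = false → P.anyOp f = false) (h : Frame P s s') :
    Frame Q s s' :=
  ⟨fun x hx => h.nat x (hPQ _ hx), fun x hx => h.real x (hPQ _ hx),
    fun x hx => h.natArr x (hPQ _ hx), fun x hx => h.realArr x (hPQ _ hx)⟩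

theorem frame_op (o : Op) (s : Store) : Frame (.op o) s (o.apply s) := by
  constructor <;> intro x hx <;> cases o <;>
    simp_all [Op.apply, Program.anyOp, Op.writesNat, Op.writesReal, Op.writesNatArr,
      Op.writesRealArr]

/-- What a program leaves untouched is read off its text. For concrete programs `anyOp` evaluates,
so such facts are closed by `rfl` and need no place in the loop invariants. -/
theorem Exec.frame {P : Program} {s s' : Store} {t : ℕ} (h : Exec P s s' t) : Frame P s s' := by
  induction h with
  | op o s => exact frame_op o s
  | seq _ _ h₁ h₂ =>
    exact (h₁.mono fun f hf => by simp_all [Program.anyOp]).trans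
      (h₂.mono fun f hf => by simp_all [Program.anyOp])
  | iteTrue _ _ h => exact h.mono fun f hf => by simp_all [Program.anyOp]
  | iteFalse _ _ h => exact h.mono fun f hf => by simp_all [Program.anyOp]
  | loopTrue _ _ _ h₁ h₂ => exact (h₁.mono fun f hf => by simp_all [Program.anyOp]).trans h₂
  | loopFalse _ => exact Frame.refl _ _

/-- Started in the memory `s`, the program `P` halts after at most `T` steps in a memory that
satisfies `Q`. -/
def Run (P : Program) (s : Store) (T : ℕ) (Q : Store → Prop) : Prop :=
  ∃ s' t, Exec P s s' t ∧ t ≤ T ∧ Q s'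

/-- The weakening may use the frame of the execution, so a postcondition needs to mention only what
the program changes. -/
theorem Run.mono {P : Program} {s : Store} {T T' : ℕ} {Q Q' : Store → Prop} (h : Run P s T Q)
    (hT : T ≤ T') (hQ : ∀ s', Frame P s s' → Q s' → Q' s') : Run P s T' Q' := by
  obtain ⟨s', t, he, ht, hq⟩ := h
  exact ⟨s', t, he, ht.trans hT, hQ s' he.frame hq⟩

theorem Run.le {P : Program} {s : Store} {T T' : ℕ} {Q : Store → Prop} (h : Run P s T Q)
    (hT : T ≤ T') : Run P s T' Q :=
  h.mono hT fun _ _ h => h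

theorem Run.seq {P P' : Program} {s : Store} {T T' : ℕ} {Q Q' : Store → Prop} (h : Run P s T Q)
    (h' : ∀ s', Frame P s s' → Q s' → Run P' s' T' Q') : Run (.seq P P') s (T + T') Q' := by
  obtain ⟨s₁, t₁, he, ht, hq⟩ := h
  obtain ⟨s₂, t₂, he', ht', hq'⟩ := h' s₁ he.frame hq
  exact ⟨s₂, t₁ + t₂, he.seq he', by omega, hq'⟩

theorem Run.ite {b : Test} {P P' : Program} {s : Store} {T : ℕ} {Q : Store → Prop}
    (h : b.Holds s → Run P s T Q) (h' : ¬ b.Holds s → Run P' s T Q) :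
    Run (.ite b P P') s (T + 1) Q := by
  by_cases hb : b.Holds s
  · obtain ⟨s', t, he, ht, hq⟩ := h hb
    exact ⟨s', t + 1, .iteTrue hb he, by omega, hq⟩
  · obtain ⟨s', t, he, ht, hq⟩ := h' hb
    exact ⟨s', t + 1, .iteFalse hb he, by omega, hq⟩

/-- A block of operations. -/
def ops : Op → List Op → Program
  | o, [] => .op o
  | o, o' :: l => .seq (.op o) (ops o' l)

/-- The effect of a list of operations. -/
noncomputable def applyOps : List Op → Store → Store
  | [], s => s
  | o :: l, s => applyOps l (o.apply s)

theorem exec_ops (o : Op) (l : List Op) (s : Store) :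
    Exec (ops o l) s (applyOps (o :: l) s) (l.length + 1) := by
  induction l generalizing o s with
  | nil => exact .op o s
  | cons o' l ih =>
    have := Exec.seq (Exec.op o s) (ih o' (o.apply s))
    rwa [Nat.add_comm 1] at this

theorem Run.ops {o : Op} {l : List Op} {s : Store} {T : ℕ} {Q : Store → Prop}
    (hT : l.length + 1 ≤ T) (h : Q (applyOps (o :: l) s)) : Run (ops o l) s T Q :=
  ⟨_, _, exec_ops o l s, hT, h⟩

/-- A loop whose body decreases a variant `v` halts after at most `v` rounds. -/
theorem Run.loop {b : Test} {P : Program} {T : ℕ} {Q : Store → Prop} (I : ℕ → Store → Prop)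
    (hI : ∀ v s, I v s → b.Holds s → Run P s T fun s' => ∃ v' < v, I v' s')
    (hQ : ∀ v s, I v s → ¬ b.Holds s → Q s) :
    ∀ v s, I v s → Run (.loop b P) s (v * (T + 1) + 1) Q := by
  intro v
  induction v using Nat.strong_induction_on with
  | _ v ih =>
    intro s hs
    by_cases hb : b.Holds s
    · obtain ⟨s₁, t₁, he, ht, v', hv', hs₁⟩ := hI v s hs hb
      obtain ⟨s₂, t₂, he', ht', hq⟩ := ih v' hv' s₁ hs₁
      refine ⟨s₂, _, .loopTrue hb he he', ?_, hq⟩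
      have : (v' + 1) * (T + 1) ≤ v * (T + 1) := Nat.mul_le_mul_right _ hv'
      have e : (v' + 1) * (T + 1) = v' * (T + 1) + (T + 1) := by ring
      omega
    · exact ⟨s, 1, .loopFalse hb, by omega, hQ v s hs hb⟩

/-- Run `body` while the register `x`, which grows by `1` in each round, is less than the register
`N`. The register `3` is supposed to hold `1`. -/
def forLoop (x N : ℕ) (body : Program) : Program :=
  .loop (.natLt x N) (.seq body (.op (.natAdd x x 3)))

/-- The store `s` with `v` in the natural register `x`. -/
def Store.setNat (s : Store) (x v : ℕ) : Store := { s with nat := Function.update s.nat x v }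

/-- The invariant is required of the memory after the counter has been increased, hence `setNat` in
`hstep`. A round costs `T` steps for the body and one each for the increment and the test. -/
theorem Run.forLoop {x N a b T : ℕ} {body : Program} {s : Store} (I : ℕ → Store → Prop)
    (ha : s.nat x = a) (hb : s.nat N = b) (h3 : s.nat 3 = 1) (hab : a ≤ b)
    (h0 : I a s)
    (hstep : ∀ k s', a ≤ k → k < b → s'.nat x = k → Frame (forLoop x N body) s s' → I k s' →
      Run body s' T fun s'' => I (k + 1) (s''.setNat x (k + 1)))
    (hx : body.anyOp (Op.writesNat x) = false := by rfl)
    (hN : (forLoop x N body).anyOp (Op.writesNat N) = false := by rfl)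
    (hone : (forLoop x N body).anyOp (Op.writesNat 3) = false := by rfl) :
    Run (forLoop x N body) s ((b - a) * (T + 2) + 1) (I b) := by
  have key := Run.loop (b := .natLt x N) (P := .seq body (.op (.natAdd x x 3))) (T := T + 1)
    (Q := I b)
    (fun v s' => ∃ k, a ≤ k ∧ k ≤ b ∧ v = b - k ∧ s'.nat x = k ∧
      Frame (RealRAM.forLoop x N body) s s' ∧ I k s') ?_ ?_ (b - a) s
      ⟨a, le_rfl, hab, rfl, ha, Frame.refl _ _, h0⟩
  · exact key
  · rintro v s' ⟨k, hak, hkb, rfl, hk, hF, hI⟩ hlt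
    have hN' : s'.nat N = b := (hF.nat N hN).trans hb
    have hkb' : k < b := by
      have : s'.nat x < s'.nat N := hlt
      omega
    refine Run.seq (hstep k s' hak hkb' hk hF hI) fun s'' hF'' hI'' => ?_
    have h1 : s''.nat x = k := (hF''.nat x hx).trans hk
    have hF2 : Frame (RealRAM.forLoop x N body) s s'' :=
      hF.trans (hF''.mono fun f hf => by
        simp only [RealRAM.forLoop, Program.anyOp, Bool.or_eq_false_iff] at hf; exact hf.1)
    have h3' : s''.nat 3 = 1 := (hF2.nat 3 hone).trans h3
    have e : (Op.natAdd x x 3).apply s'' = s''.setNat x (k + 1) := by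
      simp [Op.apply, Store.setNat, h1, h3']
    refine ⟨_, 1, .op _ _, le_rfl, b - (k + 1), by omega, k + 1, by omega, hkb', rfl, ?_, ?_, ?_⟩
    · simp [e, Store.setNat]
    · exact hF2.trans ((frame_op _ _).mono fun f hf => by
        simp only [RealRAM.forLoop, Program.anyOp, Bool.or_eq_false_iff] at hf; exact hf.2)
    · rwa [e]
  · rintro v s' ⟨k, hak, hkb, rfl, hk, hF, hI⟩ hlt
    have hN' : s'.nat N = b := (hF.nat N hN).trans hb
    have : ¬ s'.nat x < s'.nat N := hlt
    have : k = b := by omega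
    exact this ▸ hI

end RealRAM

namespace RankAgg

/-! ## Menus and truncated distances -/

theorem mem_best {n : ℕ} {S : Finset (Fin n)} {σ : Equiv.Perm (Fin n)} {x : Fin n} :
    x ∈ best S σ ↔ x ∈ S ∧ ∀ y ∈ S, y ≠ x → σ.symm x < σ.symm y := by
  rw [best, Finset.mem_filter]
  rfl

theorem best_eq_singleton {n : ℕ} {S : Finset (Fin n)} {σ : Equiv.Perm (Fin n)} {x : Fin n}
    (hx : x ∈ best S σ) : best S σ = {x} := by
  ext y
  rw [Finset.mem_singleton]
  refine ⟨fun hy => ?_, fun h => h ▸ hx⟩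
  by_contra hne
  have h1 := (mem_best.1 hx).2 y (mem_best.1 hy).1 hne
  have h2 := (mem_best.1 hy).2 x (mem_best.1 hx).1 (Ne.symm hne)
  exact lt_asymm h1 h2

theorem exists_mem_best {n : ℕ} {S : Finset (Fin n)} (hS : S.Nonempty)
    (σ : Equiv.Perm (Fin n)) : ∃ x, x ∈ best S σ := by
  obtain ⟨x, hx, hmin⟩ := Finset.exists_min_image S (fun y => σ.symm y) hS
  refine ⟨x, mem_best.2 ⟨hx, fun y hy hne => lt_of_le_of_ne (hmin y hy) fun h => hne ?_⟩⟩
  exact (σ.symm.injective h).symm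

theorem sum_symmDiff_eq {α : Type*} [DecidableEq α] (A B : Finset α) (μ : α → ℝ) :
    ∑ x ∈ symmDiff A B, μ x = ∑ x ∈ A, μ x + ∑ x ∈ B, μ x - 2 * ∑ x ∈ A ∩ B, μ x := by
  have h1 := Finset.sum_sdiff (f := μ) (Finset.inter_subset_left : A ∩ B ⊆ A)
  have h2 := Finset.sum_sdiff (f := μ) (Finset.inter_subset_right : A ∩ B ⊆ B)
  rw [Finset.sdiff_inter_self_left] at h1
  rw [Finset.sdiff_inter_self_right] at h2
  rw [symmDiff, Finset.sup_eq_union, Finset.sum_union disjoint_sdiff_sdiff]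
  linarith

/-- The weight of the menus that consist of `x` and some elements of `B`. -/
theorem sum_menus_eq_fBeta {n : ℕ} (β : ℕ → ℝ) {x : Fin n} {B : Finset (Fin n)} (hx : x ∉ B) :
    ∑ S ∈ Finset.univ.filter (fun S : Finset (Fin n) => 2 ≤ S.card ∧ x ∈ S ∧ S.erase x ⊆ B),
      β S.card = fBeta n β B.card := by
  have hBn : B.card + 1 ≤ n := by
    have := Finset.card_le_univ (insert x B)
    rwa [Finset.card_insert_of_notMem hx, Fintype.card_fin] at this
  -- Deleting `x` matches these menus with the nonempty subsets of `B`.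
  have h1 : ∑ S ∈ Finset.univ.filter
        (fun S : Finset (Fin n) => 2 ≤ S.card ∧ x ∈ S ∧ S.erase x ⊆ B), β S.card
      = ∑ T ∈ B.powerset, if 1 ≤ T.card then β (T.card + 1) else 0 := by
    rw [← Finset.sum_filter]
    refine Finset.sum_bij' (fun S _ => S.erase x) (fun T _ => insert x T) ?_ ?_ ?_ ?_ ?_
    · intro S hS
      simp only [Finset.mem_filter, Finset.mem_univ, true_and] at hS
      simp only [Finset.mem_filter, Finset.mem_powerset, Finset.card_erase_of_mem hS.2.1]
      exact ⟨hS.2.2, by omega⟩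
    · intro T hT
      simp only [Finset.mem_filter, Finset.mem_powerset] at hT
      have hxT : x ∉ T := fun h => hx (hT.1 h)
      simp only [Finset.mem_filter, Finset.mem_univ, true_and, Finset.card_insert_of_notMem hxT,
        Finset.erase_insert hxT]
      exact ⟨by omega, Finset.mem_insert_self _ _, hT.1⟩
    · intro S hS
      simp only [Finset.mem_filter, Finset.mem_univ, true_and] at hS
      exact Finset.insert_erase hS.2.1
    · intro T hT
      simp only [Finset.mem_filter, Finset.mem_powerset] at hT
      exact Finset.erase_insert fun h => hx (hT.1 h)
    · intro S hS
      simp only [Finset.mem_filter, Finset.mem_univ, true_and] at hS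
      rw [Finset.card_erase_of_mem hS.2.1]
      congr 1
      omega
  rw [h1, Finset.sum_powerset_apply_card (fun k => if 1 ≤ k then β (k + 1) else 0), fBeta]
  have h2 : ∑ k ∈ Finset.Icc 2 n, β k * (B.card.choose (k - 1) : ℝ)
      = ∑ k ∈ Finset.Icc 2 (B.card + 1), β k * (B.card.choose (k - 1) : ℝ) := by
    symm
    refine Finset.sum_subset (Finset.Icc_subset_Icc_right hBn) fun k hk hk' => ?_
    simp only [Finset.mem_Icc] at hk hk'
    rw [Nat.choose_eq_zero_of_lt (by omega)]
    simp
  -- The split-off term is that of the empty `T`, the singleton menu, whose weight was set to `0`.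
  rw [h2, Finset.sum_range_succ']
  simp only [Nat.le_add_left, if_true, nonpos_iff_eq_zero, one_ne_zero, if_false, smul_zero,
    add_zero, nsmul_eq_mul]
  refine Finset.sum_bij' (fun k _ => k + 2) (fun k _ => k - 2) ?_ ?_ ?_ ?_ ?_ <;>
    simp only [Finset.mem_range, Finset.mem_Icc] <;> intro k hk
  · omega
  · omega
  · omega
  · omega
  · rw [mul_comm]
    rfl

theorem mem_below {n : ℕ} {σ : Equiv.Perm (Fin n)} {x y : Fin n} :
    y ∈ below σ x ↔ σ.symm x < σ.symm y := by
  rw [below, Finset.mem_filter]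
  exact and_iff_right (Finset.mem_univ _)

theorem notMem_below_self {n : ℕ} (σ : Equiv.Perm (Fin n)) (x : Fin n) : x ∉ below σ x := by
  simp [mem_below]

theorem card_below {n : ℕ} (σ : Equiv.Perm (Fin n)) (p : Fin n) :
    (below σ (σ p)).card = n - (p + 1) := by
  have : (below σ (σ p)) = (Finset.Ioi p).map σ.toEmbedding := by
    ext y
    simp only [mem_below, Equiv.symm_apply_apply, Finset.mem_map_equiv, Finset.mem_Ioi]
  rw [this, Finset.card_map, Fin.card_Ioi]
  omega

theorem mem_best_iff_below {n : ℕ} {S : Finset (Fin n)} {σ : Equiv.Perm (Fin n)} {x : Fin n} :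
    x ∈ best S σ ↔ x ∈ S ∧ S.erase x ⊆ below σ x := by
  rw [mem_best]
  refine and_congr_right fun _ => ⟨fun h y hy => ?_, fun h y hy hne => ?_⟩
  · rw [Finset.mem_erase] at hy
    exact mem_below.2 (h y hy.2 hy.1)
  · exact mem_below.1 (h (Finset.mem_erase.2 ⟨hne, hy⟩))

/-- Exchange the sums over menus and candidates: `x` is the common choice from `S` iff the rest of
`S` lies below `x` in both rankings, and `sum_menus_eq_fBeta` weighs those menus. -/
theorem sum_menus_inter {n : ℕ} (β : ℕ → ℝ) (μ : Fin n → ℝ) (σ π : Equiv.Perm (Fin n)) :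
    ∑ S ∈ (Finset.univ : Finset (Finset (Fin n))).filter (fun S => 2 ≤ S.card),
        β S.card * ∑ x ∈ best S σ ∩ best S π, μ x
      = ∑ x, fBeta n β (below σ x ∩ below π x).card * μ x := by
  have h1 : ∀ S : Finset (Fin n), β S.card * ∑ x ∈ best S σ ∩ best S π, μ x
      = ∑ x, if x ∈ S ∧ S.erase x ⊆ below σ x ∩ below π x then β S.card * μ x else 0 := by
    intro S
    rw [Finset.mul_sum, ← Finset.sum_filter]
    refine Finset.sum_congr ?_ fun _ _ => rfl
    ext x
    simp only [Finset.mem_inter, mem_best_iff_below, Finset.mem_filter, Finset.mem_univ, true_and,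
      Finset.subset_inter_iff]
    tauto
  simp_rw [h1]
  rw [Finset.sum_comm]
  refine Finset.sum_congr rfl fun x _ => ?_
  rw [← sum_menus_eq_fBeta β (x := x)
    (fun h => notMem_below_self σ x (Finset.mem_inter.1 h).1), Finset.sum_mul,
    ← Finset.sum_filter, Finset.filter_filter]

theorem sum_menus {n : ℕ} (β : ℕ → ℝ) (μ : Fin n → ℝ) (σ : Equiv.Perm (Fin n)) :
    ∑ S ∈ (Finset.univ : Finset (Finset (Fin n))).filter (fun S => 2 ≤ S.card),
        β S.card * ∑ x ∈ best S σ, μ x = ∑ p : Fin n, fBeta n β (n - (p + 1)) * μ (σ p) := by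
  have := sum_menus_inter β μ σ σ
  simp only [Finset.inter_self] at this
  rw [this, ← Equiv.sum_comp σ]
  simp_rw [card_below]

/-- The contribution of the position `p` to the distance. -/
noncomputable def posTerm {n : ℕ} (β : ℕ → ℝ) (μ : Fin n → ℝ) (σ π : Equiv.Perm (Fin n))
    (p : Fin n) : ℝ :=
  fBeta n β (n - ((p : ℕ) + 1)) * (μ (σ p) + μ (π p))
    - 2 * fBeta n β (below σ (σ p) ∩ below π (σ p)).card * μ (σ p)

/-- The mass of a symmetric difference is `μ(A) + μ(B) - 2 μ(A ∩ B)`. The first two parts are summed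
along the positions of `σ` and of `π` separately; the third is indexed by candidates and is
reindexed along `σ`. -/
theorem topDist_eq_sum_posTerm {n : ℕ} (β : ℕ → ℝ) (μ : Fin n → ℝ) (σ π : Equiv.Perm (Fin n)) :
    topDist β μ σ π = ∑ p, posTerm β μ σ π p := by
  simp only [topDist, sum_symmDiff_eq, posTerm, mul_sub, mul_add, Finset.sum_add_distrib,
    Finset.sum_sub_distrib, sum_menus]
  congr 1
  simp_rw [mul_left_comm _ (2 : ℝ), ← Finset.mul_sum, mul_assoc (2 : ℝ), ← Finset.mul_sum]
  rw [sum_menus_inter, ← Equiv.sum_comp σ]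

theorem truncDist_eq {n : ℕ} (β : ℕ → ℝ) (μ : Fin n → ℝ) (σ π : Equiv.Perm (Fin n)) (b t : ℕ) :
    truncDist β μ σ π b t = ∑ p ∈ Finset.univ.filter
      (fun p : Fin n => b ≤ (p : ℕ) + 1 ∧ (p : ℕ) + 1 ≤ t), posTerm β μ σ π p := rfl

/-- The distance is the sum of its truncations to the positions up to `i`, from `i + 1` to `e`, and
from `e + 1`. -/
theorem topDist_split {n : ℕ} (β : ℕ → ℝ) (μ : Fin n → ℝ) (σ π : Equiv.Perm (Fin n)) {i e : ℕ}
    (hie : i ≤ e) :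
    topDist β μ σ π = truncDist β μ σ π 1 i + truncDist β μ σ π (i + 1) e +
      ∑ p ∈ Finset.univ.filter (fun p : Fin n => e ≤ p), posTerm β μ σ π p := by
  simp only [truncDist_eq, topDist_eq_sum_posTerm, Finset.sum_filter, ← Finset.sum_add_distrib]
  refine Finset.sum_congr rfl fun p _ => ?_
  split_ifs <;> first | omega | simp

/-- The rankings `σ` and `σ'` agree on the first `e` positions. -/
def AgreeBelow {n : ℕ} (e : ℕ) (σ σ' : Equiv.Perm (Fin n)) : Prop :=
  ∀ p : Fin n, (p : ℕ) < e → σ p = σ' p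

/-- The complement of this set consists of the candidates at positions up to `p`, where the rankings
agree. -/
theorem AgreeBelow.below_eq {n e : ℕ} {σ σ' : Equiv.Perm (Fin n)} (h : AgreeBelow e σ σ')
    {p : Fin n} (hp : (p : ℕ) < e) : below σ (σ p) = below σ' (σ' p) := by
  ext y
  rw [mem_below, mem_below, Equiv.symm_apply_apply, Equiv.symm_apply_apply, ← not_le, ← not_le,
    not_iff_not]
  constructor <;> intro hle
  · have := h (σ.symm y) (lt_of_le_of_lt (Fin.le_def.1 hle) hp)
    rw [Equiv.apply_symm_apply] at this
    rwa [this, Equiv.symm_apply_apply]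
  · have := h (σ'.symm y) (lt_of_le_of_lt (Fin.le_def.1 hle) hp)
    rw [Equiv.apply_symm_apply] at this
    rwa [← this, Equiv.symm_apply_apply]

theorem AgreeBelow.posTerm_eq {n e : ℕ} {σ σ' : Equiv.Perm (Fin n)} (h : AgreeBelow e σ σ')
    (β : ℕ → ℝ) (μ : Fin n → ℝ) (π : Equiv.Perm (Fin n)) {p : Fin n} (hp : (p : ℕ) < e) :
    posTerm β μ σ π p = posTerm β μ σ' π p := by
  rw [posTerm, posTerm, h.below_eq hp, h p hp]

theorem AgreeBelow.truncDist_eq {n b e : ℕ} {σ σ' : Equiv.Perm (Fin n)} (h : AgreeBelow e σ σ')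
    (β : ℕ → ℝ) (μ : Fin n → ℝ) (π : Equiv.Perm (Fin n)) :
    truncDist β μ σ π b e = truncDist β μ σ' π b e := by
  rw [RankAgg.truncDist_eq, RankAgg.truncDist_eq]
  refine Finset.sum_congr rfl fun p hp => ?_
  simp only [Finset.mem_filter] at hp
  exact h.posTerm_eq β μ π (by omega)

theorem StartsWith.agreeBelow {n : ℕ} {l : List (Fin n)} {σ σ' : Equiv.Perm (Fin n)}
    (h : StartsWith σ l) (h' : StartsWith σ' l) : AgreeBelow l.length σ σ' :=
  fun p hp => (h p hp).trans (h' p hp).symm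

/-! ### Sums of `fBeta` and the bound on the tail -/

theorem fBeta_nonneg {n : ℕ} {β : ℕ → ℝ} (hβ : ∀ k, 2 ≤ k → 0 ≤ β k) (t : ℕ) :
    0 ≤ fBeta n β t :=
  Finset.sum_nonneg fun k hk => mul_nonneg (hβ k (Finset.mem_Icc.1 hk).1) (Nat.cast_nonneg _)

theorem fBeta_mono {n : ℕ} {β : ℕ → ℝ} (hβ : ∀ k, 2 ≤ k → 0 ≤ β k) : Monotone (fBeta n β) := by
  intro s t hst
  refine Finset.sum_le_sum fun k hk => mul_le_mul_of_nonneg_left ?_ (hβ k (Finset.mem_Icc.1 hk).1)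
  exact_mod_cast Nat.choose_le_choose _ hst

/-- The hockey-stick identity, weighted by `β`; the induction step is Pascal's rule. -/
theorem sum_range_fBeta (n : ℕ) (β : ℕ → ℝ) (N : ℕ) :
    ∑ s ∈ Finset.range N, fBeta n β s = ∑ k ∈ Finset.Icc 2 n, β k * (N.choose k : ℝ) := by
  induction N with
  | zero =>
    refine (Finset.sum_eq_zero fun k hk => ?_).symm
    rw [Nat.choose_eq_zero_of_lt (by have := (Finset.mem_Icc.1 hk).1; omega)]
    simp
  | succ N ih =>
    rw [Finset.sum_range_succ, ih, fBeta, ← Finset.sum_add_distrib]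
    refine Finset.sum_congr rfl fun k hk => ?_
    obtain ⟨k, rfl⟩ : ∃ k', k = k' + 1 := ⟨k - 1, by have := (Finset.mem_Icc.1 hk).1; omega⟩
    rw [Nat.choose_succ_succ, Nat.add_sub_cancel]
    push_cast
    ring

/-- Counted from the end, the arguments of `fBeta` run through `0, …, n - e - 1`. The result is the
numerator in `growthSup` when `n - e = t - K`. -/
theorem sum_tail_fBeta {n e : ℕ} (β : ℕ → ℝ) :
    ∑ p ∈ Finset.univ.filter (fun p : Fin n => e ≤ p), fBeta n β (n - ((p : ℕ) + 1))
      = ∑ j ∈ Finset.Icc 2 (n - e), β j * ((n - e).choose j : ℝ) := by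
  have h1 : ∑ p ∈ Finset.univ.filter (fun p : Fin n => e ≤ p), fBeta n β (n - ((p : ℕ) + 1))
      = ∑ s ∈ Finset.range (n - e), fBeta n β s := by
    rw [Finset.sum_filter, Fin.sum_univ_eq_sum_range (fun p => if e ≤ p then fBeta n β (n - (p + 1)) else 0) n,
      ← Finset.sum_filter]
    refine Finset.sum_bij' (fun p _ => n - (p + 1)) (fun s _ => n - (s + 1)) ?_ ?_ ?_ ?_ ?_ <;>
      simp only [Finset.mem_range, Finset.mem_filter] <;> intro k hk
    on_goal 5 => trivial
    all_goals omega
  rw [h1, sum_range_fBeta]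
  symm
  refine Finset.sum_subset (Finset.Icc_subset_Icc_right (Nat.sub_le _ _)) fun k hk hk' => ?_
  simp only [Finset.mem_Icc] at hk hk'
  rw [Nat.choose_eq_zero_of_lt (by omega)]
  simp

/-- The voter's weight `μ (π p)` cancels. Dropping the intersection term of `σ` and bounding that of
`σ'` by monotonicity leaves `fBeta n β (n - (p + 1)) * (μ (σ p) + μ (σ' p))`. -/
theorem posTerm_sub_le {n : ℕ} {β : ℕ → ℝ} (hβ : ∀ k, 2 ≤ k → 0 ≤ β k) {μ : Fin n → ℝ} {U : ℝ}
    (h0 : ∀ x, 0 ≤ μ x) (hU : ∀ x, μ x ≤ U) (σ σ' π : Equiv.Perm (Fin n)) (p : Fin n) :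
    posTerm β μ σ π p - posTerm β μ σ' π p ≤ 2 * U * fBeta n β (n - ((p : ℕ) + 1)) := by
  have h1 : fBeta n β (below σ' (σ' p) ∩ below π (σ' p)).card ≤ fBeta n β (n - ((p : ℕ) + 1)) := by
    rw [← card_below σ' p]
    exact fBeta_mono hβ (Finset.card_le_card Finset.inter_subset_left)
  have h2 := mul_le_mul_of_nonneg_right h1 (h0 (σ' p))
  have h3 := mul_nonneg (fBeta_nonneg (n := n) hβ (below σ (σ p) ∩ below π (σ p)).card) (h0 (σ p))
  have h4 := mul_le_mul_of_nonneg_left (hU (σ p)) (fBeta_nonneg (n := n) hβ (n - ((p : ℕ) + 1)))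
  have h5 := mul_le_mul_of_nonneg_left (hU (σ' p)) (fBeta_nonneg (n := n) hβ (n - ((p : ℕ) + 1)))
  simp only [posTerm]
  nlinarith

end RankAgg

namespace RankAgg

/-! ## Majority candidates come first -/

/-- The disagreement of the voters with the choice `A` from the menu `S`. -/
noncomputable def menuCost {n m : ℕ} (μ : Fin n → ℝ) (V : Fin m → Equiv.Perm (Fin n))
    (S A : Finset (Fin n)) : ℝ :=
  ∑ j, ∑ x ∈ symmDiff A (best S (V j)), μ x

theorem profileDist_eq_sum_menuCost {n m : ℕ} (β : ℕ → ℝ) (μ : Fin n → ℝ)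
    (σ : Equiv.Perm (Fin n)) (V : Fin m → Equiv.Perm (Fin n)) :
    profileDist β μ σ V = ∑ S ∈ (Finset.univ : Finset (Finset (Fin n))).filter
      (fun S => 2 ≤ S.card), β S.card * menuCost μ V S (best S σ) := by
  simp only [profileDist, topDist, menuCost, Finset.mul_sum]
  rw [Finset.sum_comm]

/-- Here `v` is a voter's choice, and `a` is replaced by `c`. The worst case is `v = a`; for any
other `v ≠ c` the change is only `μ c - μ a`. -/
theorem sum_symmDiff_singleton_le {n : ℕ} {μ : Fin n → ℝ} (h0 : ∀ x, 0 ≤ μ x) {a c v : Fin n}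
    (hac : a ≠ c) :
    ∑ x ∈ symmDiff {c} {v}, μ x - ∑ x ∈ symmDiff {a} {v}, μ x
      ≤ if v = c then -(μ a + μ c) else μ a + μ c := by
  simp only [sum_symmDiff_eq, Finset.sum_singleton]
  have ha := h0 a
  have hc := h0 c
  by_cases hvc : v = c
  · subst hvc
    have : ({a} : Finset (Fin n)) ∩ {v} = ∅ := by simp [hac]
    simp only [Finset.inter_self, Finset.sum_singleton, this, Finset.sum_empty, if_true]
    linarith
  · have : ({c} : Finset (Fin n)) ∩ {v} = ∅ := by simp [Ne.symm hvc]
    simp only [this, Finset.sum_empty, if_neg hvc]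
    by_cases hva : v = a
    · subst hva
      simp only [Finset.inter_self, Finset.sum_singleton]
      linarith
    · have : ({a} : Finset (Fin n)) ∩ {v} = ∅ := by simp [Ne.symm hva]
      simp only [this, Finset.sum_empty]
      linarith

/-- A majority candidate is a best choice from each menu that contains it. -/
theorem IsMajority.menuCost_le {n m : ℕ} {μ : Fin n → ℝ} (h0 : ∀ x, 0 ≤ μ x)
    {V : Fin m → Equiv.Perm (Fin n)} {Q S : Finset (Fin n)} {c : Fin n} (hc : IsMajority V Q c)
    (hS : S ⊆ Q) (hcS : c ∈ S) (a : Fin n) : menuCost μ V S {c} ≤ menuCost μ V S {a} := by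
  by_cases hac : a = c
  · rw [hac]
  rw [← sub_nonpos, menuCost, menuCost, ← Finset.sum_sub_distrib]
  set J := Finset.univ.filter fun j : Fin m => ∀ a ∈ Q.erase c, Prefers (V j) c a with hJ
  -- A voter in `J` puts `c` first in `Q`, hence in `S`, and gains `μ a + μ c`; any other voter
  -- loses at most as much. Since `|J| > m / 2`, the gains prevail.
  have h1 : ∀ j, (∑ x ∈ symmDiff {c} (best S (V j)), μ x - ∑ x ∈ symmDiff {a} (best S (V j)), μ x)
      ≤ (if j ∈ J then -(2 * (μ a + μ c)) else 0) + (μ a + μ c) := by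
    intro j
    obtain ⟨v, hv⟩ := exists_mem_best ⟨c, hcS⟩ (V j)
    rw [best_eq_singleton hv]
    refine (sum_symmDiff_singleton_le h0 hac).trans ?_
    by_cases hj : j ∈ J
    · have hcb : c ∈ best S (V j) := mem_best.2 ⟨hcS, fun y hy hne =>
        (Finset.mem_filter.1 hj).2 y (Finset.mem_erase.2 ⟨hne, hS hy⟩)⟩
      rw [best_eq_singleton hv, Finset.mem_singleton] at hcb
      rw [if_pos hcb.symm, if_pos hj]
      linarith
    · rw [if_neg hj, zero_add]
      split_ifs
      · linarith [h0 a, h0 c]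
      · exact le_rfl
  refine (Finset.sum_le_sum fun j _ => h1 j).trans ?_
  rw [Finset.sum_add_distrib, ← Finset.sum_filter, Finset.sum_const, Finset.sum_const,
    Finset.filter_mem_eq_inter, Finset.univ_inter, Finset.card_univ, Fintype.card_fin,
    nsmul_eq_mul, nsmul_eq_mul]
  have h2 : (m : ℝ) / 2 < J.card := hc.2
  nlinarith [h0 a, h0 c]

/-- The remaining candidates are those that a ranking with the prefix `l` places after `l`. -/
theorem LoopReaches.mem_iff {n m : ℕ} {V : Fin m → Equiv.Perm (Fin n)} {l : List (Fin n)}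
    {Q : Finset (Fin n)} (h : LoopReaches V l Q) {ω : Equiv.Perm (Fin n)} (hω : StartsWith ω l) :
    l.length ≤ n ∧ ∀ x, x ∈ Q ↔ l.length ≤ ω.symm x := by
  induction h with
  | start => simp
  | @step l Q c _ hc ih =>
    have hω' : StartsWith ω l := fun p hp => by
      have := hω p (by simp only [List.length_append]; omega)
      rwa [List.getElem_append_left hp] at this
    obtain ⟨hl, hQ⟩ := ih hω'
    have hlt : l.length < n := lt_of_le_of_lt ((hQ c).1 hc.1) (ω.symm c).2
    have hcl : ω ⟨l.length, hlt⟩ = c := by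
      have := hω ⟨l.length, hlt⟩ (by simp)
      simpa using this
    refine ⟨by simpa using hlt, fun x => ?_⟩
    rw [Finset.mem_erase, hQ, List.length_append, List.length_singleton]
    have : x ≠ c ↔ (ω.symm x : ℕ) ≠ l.length := by
      rw [not_iff_not, ← hcl, ← Equiv.symm_apply_eq, Fin.ext_iff]
    rw [this]
    omega

theorem LoopReaches.card_eq {n m : ℕ} {V : Fin m → Equiv.Perm (Fin n)} {l : List (Fin n)}
    {Q : Finset (Fin n)} (h : LoopReaches V l Q) {ω : Equiv.Perm (Fin n)} (hω : StartsWith ω l) :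
    Q.card = n - l.length := by
  obtain ⟨hl, hQ⟩ := h.mem_iff hω
  have e : Q = (Finset.univ.filter fun p : Fin n => l.length ≤ p).map ω.toEmbedding := by
    ext x
    simp [hQ, Finset.mem_map_equiv]
  have : (Finset.univ.filter fun p : Fin n => l.length ≤ p).card = n - l.length := by
    have h1 := Fin.card_filter_val_lt (n := n) (m := l.length)
    have h2 := Finset.card_filter_add_card_filter_not (s := (Finset.univ : Finset (Fin n)))
      (fun p => (p : ℕ) < l.length)
    simp only [not_lt, Finset.card_univ, Fintype.card_fin] at h2
    omega
  rw [e, Finset.card_map, this]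

/-- Exchanging two neighbours changes the choice only from menus that contain both. -/
theorem best_mul_swap {n : ℕ} {ω : Equiv.Perm (Fin n)} {p q : Fin n} (hpq : (q : ℕ) = p + 1)
    {S : Finset (Fin n)} (hS : S.Nonempty) :
    best S (ω * Equiv.swap p q) = best S ω ∨
      (best S (ω * Equiv.swap p q) = {ω q} ∧ ω q ∈ S ∧ ∀ y ∈ S, p ≤ ω.symm y) := by
  have hsymm : ∀ y, (ω * Equiv.swap p q).symm y = Equiv.swap p q (ω.symm y) := fun y => by
    rw [Equiv.symm_apply_eq, Equiv.Perm.mul_apply, Equiv.swap_apply_self, Equiv.apply_symm_apply]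
  obtain ⟨t, ht⟩ := exists_mem_best hS ω
  have ht' := mem_best.1 ht
  by_cases h : t = ω p ∧ ω q ∈ S
  · obtain ⟨rfl, hq⟩ := h
    refine Or.inr ⟨best_eq_singleton (mem_best.2 ⟨hq, fun y hy hne => ?_⟩), hq, fun y hy => ?_⟩
    · rw [hsymm, hsymm, Equiv.symm_apply_apply, Equiv.swap_apply_right, Equiv.swap_apply_def]
      have hyq : ω.symm y ≠ q := fun h => hne (by rw [← h, Equiv.apply_symm_apply])
      rw [if_neg hyq]
      split_ifs with hyp
      · rw [Fin.lt_def]; omega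
      · have := ht'.2 y hy fun h => hyp (by rw [h, Equiv.symm_apply_apply])
        rwa [Equiv.symm_apply_apply] at this
    · by_cases hyp : y = ω p
      · rw [hyp, Equiv.symm_apply_apply]
      · have := ht'.2 y hy hyp
        rw [Equiv.symm_apply_apply] at this
        exact this.le
  · left
    rw [best_eq_singleton ht]
    refine best_eq_singleton (mem_best.2 ⟨ht'.1, fun y hy hne => ?_⟩)
    have hlt := ht'.2 y hy hne
    have h1 : ω.symm t = p → ω.symm y ≠ q := fun h1 h2 => h
      ⟨by rw [← h1, Equiv.apply_symm_apply], by rwa [← h2, Equiv.apply_symm_apply]⟩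
    rw [hsymm, hsymm, Equiv.swap_apply_def, Equiv.swap_apply_def]
    rw [Fin.lt_def] at hlt ⊢
    simp only [ne_eq, Fin.ext_iff] at h1 ⊢
    split_ifs <;> omega

/-- Each majority candidate is promoted by exchanges with its upper neighbour. Such an exchange
changes choices only to that candidate, and only from menus inside `Q`, so no menu becomes more
expensive. -/
theorem LoopReaches.exists_startsWith_profileDist_le {n m : ℕ} {β : ℕ → ℝ}
    (hβ : ∀ k, 2 ≤ k → 0 ≤ β k) {μ : Fin n → ℝ} (h0 : ∀ x, 0 ≤ μ x)
    {V : Fin m → Equiv.Perm (Fin n)} {l : List (Fin n)} {Q : Finset (Fin n)}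
    (h : LoopReaches V l Q) (σ : Equiv.Perm (Fin n)) :
    ∃ ω, StartsWith ω l ∧ profileDist β μ ω V ≤ profileDist β μ σ V := by
  induction h with
  | start => exact ⟨σ, fun p hp => absurd hp (Nat.not_lt_zero _), le_rfl⟩
  | @step l Q c hl hc ih =>
    obtain ⟨ω₀, hω₀, hd₀⟩ := ih
    -- Induction on the number `d` of places by which `c` still has to rise.
    have key : ∀ d : ℕ, ∀ ω : Equiv.Perm (Fin n), StartsWith ω l →
        profileDist β μ ω V ≤ profileDist β μ σ V → (ω.symm c : ℕ) = l.length + d →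
        ∃ ω, StartsWith ω (l ++ [c]) ∧ profileDist β μ ω V ≤ profileDist β μ σ V := by
      intro d
      induction d with
      | zero =>
        intro ω hω hd hp
        refine ⟨ω, fun p hp' => ?_, hd⟩
        rw [List.length_append, List.length_singleton] at hp'
        by_cases hpl : (p : ℕ) < l.length
        · rw [List.getElem_append_left hpl]
          exact hω p hpl
        · have : p = ω.symm c := Fin.ext (by omega)
          have hpc : ω p = c := by rw [this, Equiv.apply_symm_apply]
          rw [List.getElem_append_right (by omega), hpc]
          simp
      | succ d ihd =>
        intro ω hω hd hp
        have hn := (ω.symm c).2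
        set q := ω.symm c with hq
        have hcq : ω q = c := by rw [hq, Equiv.apply_symm_apply]
        set p : Fin n := ⟨l.length + d, by omega⟩ with hpdef
        have hpv : (p : ℕ) = l.length + d := rfl
        refine ihd (ω * Equiv.swap p q) (fun r hr => ?_) ?_ ?_
        · rw [Equiv.Perm.mul_apply, Equiv.swap_apply_of_ne_of_ne]
          · exact hω r hr
          · intro h; rw [h] at hr; omega
          · intro h; rw [h] at hr; omega
        · refine le_trans ?_ hd
          rw [profileDist_eq_sum_menuCost, profileDist_eq_sum_menuCost]
          refine Finset.sum_le_sum fun S hS => ?_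
          have hS2 := (Finset.mem_filter.1 hS).2
          have hSne : S.Nonempty := Finset.card_pos.1 (by omega)
          refine mul_le_mul_of_nonneg_left ?_ (hβ _ hS2)
          rcases best_mul_swap (ω := ω) (p := p) (q := q) (by omega) hSne with h | ⟨h, hqS, hge⟩
          · rw [h]
          · obtain ⟨a, ha⟩ := exists_mem_best hSne ω
            rw [h, best_eq_singleton ha, hcq]
            -- As the choice has changed, all of `S` lies at positions `≥ p ≥ l.length`, that is, in
            -- `Q`.
            refine hc.menuCost_le h0 (fun y hy => ?_) (hcq ▸ hqS) a
            rw [(hl.mem_iff hω).2]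
            have := Fin.le_def.1 (hge y hy)
            omega
        · have : (ω * Equiv.swap p q).symm c = p := by
            rw [Equiv.symm_apply_eq, Equiv.Perm.mul_apply, Equiv.swap_apply_left, hcq]
          rw [this]
    have hcQ := ((hl.mem_iff hω₀).2 c).1 hc.1
    exact key ((ω₀.symm c : ℕ) - l.length) ω₀ hω₀ hd₀ (by omega)

/-! ## The approximation guarantee -/

/-- The weight of the menus `S ⊆ Q` that contain two given elements of `Q`. -/
theorem sum_menus_pair {n : ℕ} (β : ℕ → ℝ) {Q : Finset (Fin n)} {a c : Fin n} (ha : a ∈ Q)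
    (hc : c ∈ Q) (hac : a ≠ c) :
    ∑ S ∈ Finset.univ.filter (fun S : Finset (Fin n) => S ⊆ Q ∧ a ∈ S ∧ c ∈ S), β S.card
      = ∑ j ∈ Finset.Icc 0 (Q.card - 2), β (j + 2) * ((Q.card - 2).choose j : ℝ) := by
  have hB : ((Q.erase a).erase c).card = Q.card - 2 := by
    rw [Finset.card_erase_of_mem (Finset.mem_erase.2 ⟨hac.symm, hc⟩), Finset.card_erase_of_mem ha]
    omega
  have h1 : ∑ S ∈ Finset.univ.filter (fun S : Finset (Fin n) => S ⊆ Q ∧ a ∈ S ∧ c ∈ S), β S.card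
      = ∑ T ∈ ((Q.erase a).erase c).powerset, β (T.card + 2) := by
    refine Finset.sum_bij' (fun S _ => (S.erase a).erase c) (fun T _ => insert a (insert c T))
      ?_ ?_ ?_ ?_ ?_
    · intro S hS
      simp only [Finset.mem_filter, Finset.mem_univ, true_and] at hS
      exact Finset.mem_powerset.2 (Finset.erase_subset_erase _ (Finset.erase_subset_erase _ hS.1))
    · intro T hT
      have hT' := Finset.mem_powerset.1 hT
      simp only [Finset.mem_filter, Finset.mem_univ, true_and, Finset.mem_insert, true_or,
        or_true, and_true, Finset.insert_subset_iff]
      exact ⟨ha, hc, hT'.trans ((Finset.erase_subset _ _).trans (Finset.erase_subset _ _))⟩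
    · intro S hS
      simp only [Finset.mem_filter, Finset.mem_univ, true_and] at hS
      rw [Finset.insert_erase (Finset.mem_erase.2 ⟨hac.symm, hS.2.2⟩), Finset.insert_erase hS.2.1]
    · intro T hT
      have hT' := Finset.mem_powerset.1 hT
      have hcT : c ∉ T := fun h => by simpa using hT' h
      have haT : a ∉ insert c T := fun h => by
        rcases Finset.mem_insert.1 h with h | h
        · exact hac h
        · simpa using hT' h
      rw [Finset.erase_insert haT, Finset.erase_insert hcT]
    · intro S hS
      simp only [Finset.mem_filter, Finset.mem_univ, true_and] at hS
      have h2 : 2 ≤ S.card := by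
        have := Finset.card_le_card (show {a, c} ⊆ S from by
          simp [Finset.insert_subset_iff, hS.2.1, hS.2.2])
        rwa [Finset.card_pair hac] at this
      rw [Finset.card_erase_of_mem (Finset.mem_erase.2 ⟨hac.symm, hS.2.2⟩),
        Finset.card_erase_of_mem hS.2.1]
      congr 1
      omega
  rw [h1, Finset.sum_powerset_apply_card (fun k => β (k + 2)), hB, Finset.range_eq_Ico]
  simp only [nsmul_eq_mul]
  exact Finset.sum_congr rfl fun _ _ => mul_comm _ _

/-- Without a majority candidate, each ranking is far from the profile. -/
theorem le_profileDist_of_forall_not_isMajority {n m : ℕ} {β : ℕ → ℝ}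
    (hβ : ∀ k, 2 ≤ k → 0 ≤ β k) {μ : Fin n → ℝ} {u : ℝ} (hu : 0 ≤ u) (hμ : ∀ x, u ≤ μ x)
    {V : Fin m → Equiv.Perm (Fin n)} {Q : Finset (Fin n)} (hQ : Q.Nonempty)
    (hno : ¬ ∃ c, IsMajority V Q c) (σ : Equiv.Perm (Fin n)) :
    m * u * ∑ j ∈ Finset.Icc 0 (Q.card - 2), β (j + 2) * ((Q.card - 2).choose j : ℝ)
      ≤ profileDist β μ σ V := by
  set D := ∑ j ∈ Finset.Icc 0 (Q.card - 2), β (j + 2) * ((Q.card - 2).choose j : ℝ) with hD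
  have hD0 : 0 ≤ D := Finset.sum_nonneg fun j _ => mul_nonneg (hβ _ (by omega)) (Nat.cast_nonneg _)
  have hμ0 : ∀ x, 0 ≤ μ x := fun x => hu.trans (hμ x)
  obtain ⟨c, hc⟩ := exists_mem_best hQ σ
  set J := Finset.univ.filter fun j : Fin m => ∀ a ∈ Q.erase c, Prefers (V j) c a with hJ
  have hJm : (J.card : ℝ) ≤ m / 2 := by
    by_contra hlt
    exact hno ⟨c, (mem_best.1 hc).1, not_le.1 hlt⟩
  -- A voter outside `J` has a favourite `a ≠ c` in `Q` and pays `μ a + μ c ≥ 2 * u`, times the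
  -- menu's weight, on each menu inside `Q` that contains both. At least `m / 2` voters are of this
  -- kind.
  have h1 : ∀ j, (if j ∈ J then 0 else 2 * u * D) ≤ topDist β μ σ (V j) := by
    intro j
    have hterm : ∀ S : Finset (Fin n), 2 ≤ S.card →
        0 ≤ β S.card * ∑ x ∈ symmDiff (best S σ) (best S (V j)), μ x := fun S hS =>
      mul_nonneg (hβ _ hS) (Finset.sum_nonneg fun x _ => hμ0 x)
    split_ifs with hj
    · exact Finset.sum_nonneg fun S hS => hterm S (Finset.mem_filter.1 hS).2
    · obtain ⟨a, ha⟩ := exists_mem_best hQ (V j)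
      have haQ := (mem_best.1 ha).1
      have hcQ := (mem_best.1 hc).1
      have hac : a ≠ c := by
        rintro rfl
        exact hj (Finset.mem_filter.2 ⟨Finset.mem_univ _, fun y hy =>
          (mem_best.1 ha).2 y (Finset.mem_erase.1 hy).2 (Finset.mem_erase.1 hy).1⟩)
      rw [hD, ← sum_menus_pair β haQ hcQ hac, Finset.mul_sum]
      have hsub : Finset.univ.filter (fun S : Finset (Fin n) => S ⊆ Q ∧ a ∈ S ∧ c ∈ S) ⊆
          Finset.univ.filter (fun S : Finset (Fin n) => 2 ≤ S.card) := by
        intro S hS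
        simp only [Finset.mem_filter, Finset.mem_univ, true_and] at hS ⊢
        have := Finset.card_le_card (show {a, c} ⊆ S from by
          simp [Finset.insert_subset_iff, hS.2.1, hS.2.2])
        rwa [Finset.card_pair hac] at this
      refine le_trans (Finset.sum_le_sum fun S hS => ?_) (Finset.sum_le_sum_of_subset_of_nonneg hsub
        fun S hS _ => hterm S (Finset.mem_filter.1 hS).2)
      have hS2 := (Finset.mem_filter.1 (hsub hS)).2
      simp only [Finset.mem_filter, Finset.mem_univ, true_and] at hS
      have e1 : best S σ = {c} := best_eq_singleton (mem_best.2 ⟨hS.2.2, fun y hy hne =>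
        (mem_best.1 hc).2 y (hS.1 hy) hne⟩)
      have e2 : best S (V j) = {a} := best_eq_singleton (mem_best.2 ⟨hS.2.1, fun y hy hne =>
        (mem_best.1 ha).2 y (hS.1 hy) hne⟩)
      have e3 : ({c} : Finset (Fin n)) ∩ {a} = ∅ := by simp [hac.symm]
      rw [e1, e2, sum_symmDiff_eq, e3, Finset.sum_empty, Finset.sum_singleton,
        Finset.sum_singleton, mul_comm]
      exact mul_le_mul_of_nonneg_left (by linarith [hμ a, hμ c]) (hβ _ hS2)
  refine le_trans ?_ (Finset.sum_le_sum fun j _ => h1 j)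
  have h2 : ∀ j, (if j ∈ J then 0 else 2 * u * D) = 2 * u * D - if j ∈ J then 2 * u * D else 0 :=
    fun j => by split_ifs <;> ring
  simp_rw [h2]
  rw [Finset.sum_sub_distrib, ← Finset.sum_filter, Finset.sum_const, Finset.sum_const,
    Finset.filter_mem_eq_inter, Finset.univ_inter, Finset.card_univ, Fintype.card_fin,
    nsmul_eq_mul, nsmul_eq_mul]
  nlinarith [mul_nonneg hu hD0]

theorem quotient_le_of_growthSup_le {β : ℕ → ℝ} {K : ℕ} {δ : ℝ} (hδ : 0 ≤ δ)
    (h : growthSup β K ≤ ENNReal.ofReal δ) {t : ℕ} (ht : max K 2 ≤ t) :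
    (∑ j ∈ Finset.Icc 2 (t - K), β j * ((t - K).choose j : ℝ)) /
      (∑ j ∈ Finset.Icc 0 (t - 2), β (j + 2) * ((t - 2).choose j : ℝ)) ≤ δ := by
  rw [← ENNReal.ofReal_le_ofReal_iff hδ]
  exact (le_iSup₂_of_le (f := fun (t : ℕ) (_ : max K 2 ≤ t) => ENNReal.ofReal
    ((∑ j ∈ Finset.Icc 2 (t - K), β j * ((t - K).choose j : ℝ)) /
      (∑ j ∈ Finset.Icc 0 (t - 2), β (j + 2) * ((t - 2).choose j : ℝ)))) t ht le_rfl).trans h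

/-- The limit makes the set nonempty, so that `sInf` is a true minimum and not the default value
`0`. -/
theorem depth_mem_depthSet {β : ℕ → ℝ} (hlim : Tendsto (growthSup β) atTop (𝓝 0)) {δ : ℝ}
    (hδ : 0 < δ) : sInf (depthSet β δ) ∈ depthSet β δ := by
  refine Nat.sInf_mem ?_
  have h := (hlim.eventually (gt_mem_nhds (ENNReal.ofReal_pos.2 hδ))).and (eventually_ge_atTop 1)
  obtain ⟨K, hK, hK1⟩ := h.exists
  exact ⟨K, hK1, hK.le⟩

/-- The comparison goes through a ranking `ω` with the output's prefix and at most the cost of `σ'`: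
equal prefix costs, a window that is no worse, and a tail loss of at most `ε` times the cost of `ω`.
-/
theorem IsMyopicTopOutput.profileDist_le {n m K : ℕ} {β : ℕ → ℝ}
    (hβ : ∀ k, 2 ≤ k → 0 ≤ β k) (hβ2 : 0 < β 2) {μ : Fin n → ℝ} {u U ε : ℝ} (hu : 0 < u)
    (hU : 0 < U) (hε : 0 < ε)
    (hμ : ∀ i, u ≤ μ i ∧ μ i ≤ U) (hK : growthSup β K ≤ ENNReal.ofReal (u * ε / (12 * U)))
    {V : Fin m → Equiv.Perm (Fin n)} {σ : Equiv.Perm (Fin n)}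
    (hσ : IsMyopicTopOutput K V β μ σ) (σ' : Equiv.Perm (Fin n)) :
    profileDist β μ σ V ≤ (1 + ε) * profileDist β μ σ' V := by
  obtain ⟨l, Q, hl, hno, hσl, hmin⟩ := hσ
  have hμ0 : ∀ x, 0 ≤ μ x := fun x => hu.le.trans (hμ x).1
  obtain ⟨ω, hω, hωle⟩ := hl.exists_startsWith_profileDist_le hβ hμ0 σ'
  have hcard := hl.card_eq hσl
  have hln := (hl.mem_iff hσl).1
  set e := l.length + min K Q.card with he
  have hdist0 : ∀ σ, 0 ≤ profileDist β μ σ V := fun σ => Finset.sum_nonneg fun j _ =>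
    Finset.sum_nonneg fun S hS => mul_nonneg (hβ _ (Finset.mem_filter.1 hS).2)
      (Finset.sum_nonneg fun x _ => hμ0 x)
  have hsplit : ∀ σ, profileDist β μ σ V = (∑ j, truncDist β μ σ (V j) 1 l.length) +
      profileTruncDist β μ σ V (l.length + 1) e +
      ∑ j, ∑ p ∈ Finset.univ.filter (fun p : Fin n => e ≤ p), posTerm β μ σ (V j) p := by
    intro σ
    rw [profileDist, profileTruncDist, ← Finset.sum_add_distrib, ← Finset.sum_add_distrib]
    exact Finset.sum_congr rfl fun j _ => topDist_split β μ σ (V j) (by omega)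
  have hpre : ∑ j, truncDist β μ σ (V j) 1 l.length = ∑ j, truncDist β μ ω (V j) 1 l.length :=
    Finset.sum_congr rfl fun j _ => (hσl.agreeBelow hω).truncDist_eq β μ (V j)
  have htail : (∑ j, ∑ p ∈ Finset.univ.filter (fun p : Fin n => e ≤ p), posTerm β μ σ (V j) p) -
      ∑ j, ∑ p ∈ Finset.univ.filter (fun p : Fin n => e ≤ p), posTerm β μ ω (V j) p ≤
      m * (2 * U * ∑ j ∈ Finset.Icc 2 (n - e), β j * ((n - e).choose j : ℝ)) := by
    rw [← Finset.sum_sub_distrib]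
    have : ∀ j ∈ (Finset.univ : Finset (Fin m)),
        (∑ p ∈ Finset.univ.filter (fun p : Fin n => e ≤ p), posTerm β μ σ (V j) p -
        ∑ p ∈ Finset.univ.filter (fun p : Fin n => e ≤ p), posTerm β μ ω (V j) p) ≤
        2 * U * ∑ j ∈ Finset.Icc 2 (n - e), β j * ((n - e).choose j : ℝ) := by
      intro j _
      rw [← Finset.sum_sub_distrib, ← sum_tail_fBeta (e := e) β, Finset.mul_sum]
      exact Finset.sum_le_sum fun p _ => posTerm_sub_le hβ hμ0 (fun x => (hμ x).2) σ ω (V j) p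
    refine (Finset.sum_le_sum this).trans ?_
    rw [Finset.sum_const, Finset.card_univ, Fintype.card_fin, nsmul_eq_mul]
  -- The constant `12` is not tight: the tail loss is at most `ε / 6` times the cost of `ω`.
  have hbound : m * (2 * U * ∑ j ∈ Finset.Icc 2 (n - e), β j * ((n - e).choose j : ℝ)) ≤
      ε * profileDist β μ ω V := by
    by_cases hKQ : max K 2 ≤ Q.card
    · have h1 := quotient_le_of_growthSup_le (by positivity) hK hKQ
      have hne : n - e = Q.card - K := by omega
      rw [hne]
      set A := ∑ j ∈ Finset.Icc 2 (Q.card - K), β j * ((Q.card - K).choose j : ℝ)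
      set D := ∑ j ∈ Finset.Icc 0 (Q.card - 2), β (j + 2) * ((Q.card - 2).choose j : ℝ)
      have hD : 0 < D := by
        refine Finset.sum_pos' (fun j _ => mul_nonneg (hβ _ (by omega)) (Nat.cast_nonneg _))
          ⟨0, by simp, by simpa using hβ2⟩
      have h2 : m * u * D ≤ profileDist β μ ω V := le_profileDist_of_forall_not_isMajority hβ hu.le
        (fun x => (hμ x).1) (Finset.card_pos.1 (by omega)) hno ω
      rw [div_le_iff₀ hD] at h1
      have hmR : (0 : ℝ) ≤ m := Nat.cast_nonneg _
      calc (m : ℝ) * (2 * U * A) ≤ m * (2 * U * (u * ε / (12 * U) * D)) := by gcongr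
        _ = ε * (m * u * D) / 6 := by field_simp; ring
        _ ≤ ε * profileDist β μ ω V := by
          have : 0 ≤ ε * (m * u * D) := by positivity
          have := mul_le_mul_of_nonneg_left h2 hε.le
          linarith
    -- Either the window reaches the last position or at most one candidate remained; a sum from `j
    -- = 2` is then empty.
    · have hne : n - e ≤ 1 := by omega
      rw [Finset.Icc_eq_empty (by omega), Finset.sum_empty, mul_zero, mul_zero]
      exact mul_nonneg hε.le (hdist0 ω)
  have hle := hmin ω hω
  have hσ1 := hsplit σ
  have hω1 := hsplit ω
  have : ε * profileDist β μ ω V ≤ ε * profileDist β μ σ' V :=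
    mul_le_mul_of_nonneg_left hωle hε.le
  linarith

end RankAgg

namespace RealRAM

/-! ## The positions of the candidates -/

/-- Distinct voters use disjoint blocks of cells, so filling one block does not damage the others.
-/
theorem index_inj {n j j' p p' : ℕ} (hp : p < n) (hp' : p' < n) (h : j * n + p = j' * n + p') :
    j = j' ∧ p = p' := by
  have hn : 0 < n := by omega
  have h1 := congrArg (· / n) h
  have h2 := congrArg (· % n) h
  simp only [Nat.mul_add_mod_self_right, Nat.mod_eq_of_lt hp, Nat.mod_eq_of_lt hp'] at h2
  simp only [mul_comm _ n, Nat.mul_add_div hn, Nat.div_eq_of_lt hp, Nat.div_eq_of_lt hp'] at h1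
  exact ⟨by omega, h2⟩

/-- Store the position of the candidate `x` in the ranking of voter `j` in the cell `j * n + x` of
the natural array `2`. -/
def voterPositions : Program :=
  .seq (ops (.natConst 7 0) [.natConst 8 0])
    (forLoop 7 1 (.seq (ops (.natConst 9 0) [])
      (.seq (forLoop 9 0 (ops (.natAdd 11 8 9) [.natLoad 12 0 11, .natAdd 11 8 12,
        .natStore 2 11 9])) (ops (.natAdd 8 8 0) []))))

theorem run_voterPositions {n m : ℕ} {V : Fin m → Equiv.Perm (Fin n)} {s : Store}
    (hn : s.nat 0 = n) (hm : s.nat 1 = m) (h3 : s.nat 3 = 1)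
    (hV : ∀ (j : Fin m) (p : Fin n), s.natArr 0 (j * n + p) = V j p) :
    Run voterPositions s (m * (n * 6 + 5) + 3) fun s' =>
      ∀ (j : Fin m) (x : Fin n), s'.natArr 2 (j * n + x) = (V j).symm x := by
  refine Run.le (T := 2 + ((m - 0) * ((1 + (((n - 0) * (4 + 2) + 1) + 1)) + 2) + 1)) ?_
    (by rw [Nat.sub_zero, Nat.sub_zero]; apply le_of_eq; ring)
  refine Run.seq (Q := fun s' => s'.nat 7 = 0 ∧ s'.nat 8 = 0) (Run.ops le_rfl ?_) fun s₁ F₁ h₁ => ?_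
  · simp [applyOps, Op.apply]
  refine Run.mono (Run.forLoop (fun j s' => s'.nat 8 = j * n ∧
    ∀ j' : Fin m, j' < j → ∀ x : Fin n, s'.natArr 2 (j' * n + x) = (V j').symm x) h₁.1
      ((F₁.nat 1 rfl).trans hm) ((F₁.nat 3 rfl).trans h3) (Nat.zero_le _) ?_ ?_)
      le_rfl fun s' _ h j x => h.2 j j.2 x
  · simp [h₁.2]
  · intro j s₂ _ hj h7 F₂ ⟨h8, hI⟩
    lift j to Fin m using hj
    have e0 : s₂.nat 0 = n := (F₂.nat 0 rfl).trans ((F₁.nat 0 rfl).trans hn)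
    have e3 : s₂.nat 3 = 1 := (F₂.nat 3 rfl).trans ((F₁.nat 3 rfl).trans h3)
    have eV : s₂.natArr 0 = s.natArr 0 := (F₂.natArr 0 rfl).trans (F₁.natArr 0 rfl)
    refine Run.seq (Q := fun s' => s'.nat 9 = 0) (Run.ops le_rfl ?_) fun s₃ F₃ h₃ => ?_
    · simp [applyOps, Op.apply]
    refine Run.seq (Run.forLoop (fun r s' => (∀ j' : Fin m, j' < j → ∀ x : Fin n,
        s'.natArr 2 (j' * n + x) = (V j').symm x) ∧ ∀ x : Fin n, ((V j).symm x : ℕ) < r →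
        s'.natArr 2 (j * n + x) = (V j).symm x)
      h₃ ((F₃.nat 0 rfl).trans e0) ((F₃.nat 3 rfl).trans e3) (Nat.zero_le _) ?_ ?_)
      fun s₄ F₄ h₄ => Run.ops le_rfl ?_
    · exact ⟨fun j' hj' x => by rw [F₃.natArr 2 rfl]; exact hI j' hj' x,
        fun x hx => absurd hx (Nat.not_lt_zero _)⟩
    · intro r s₄ _ hr h9 F₄ ⟨hA, hB⟩
      lift r to Fin n using hr
      have f8 : s₄.nat 8 = j * n := (F₄.nat 8 rfl).trans ((F₃.nat 8 rfl).trans h8)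
      have fV : s₄.natArr 0 (j * n + r) = V j r := by
        rw [F₄.natArr 0 rfl, F₃.natArr 0 rfl, eV, hV]
      refine Run.ops le_rfl ⟨fun j' hj' x => ?_, fun x hx => ?_⟩
      · have hne : (j' : ℕ) * n + x ≠ j * n + (V j r : ℕ) := fun h => by
          have := (index_inj x.2 (V j r).2 h).1
          omega
        simp [applyOps, Op.apply, Store.setNat, f8, h9, fV, hne, hA j' hj' x]
      · by_cases hxr : x = V j r
        · subst hxr
          simp [applyOps, Op.apply, Store.setNat, f8, h9, fV]
        · have hlt : ((V j).symm x : ℕ) < r := by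
            have : (V j).symm x ≠ r := fun h => hxr (by rw [← h, Equiv.apply_symm_apply])
            have := Fin.val_ne_of_ne this
            omega
          have hxr' : (x : ℕ) ≠ V j r := fun h => hxr (Fin.ext h)
          simp [applyOps, Op.apply, Store.setNat, f8, h9, fV, hxr', hB x hlt]
    · have f8 : s₄.nat 8 = j * n := (F₄.nat 8 rfl).trans ((F₃.nat 8 rfl).trans h8)
      have f0 : s₄.nat 0 = n := (F₄.nat 0 rfl).trans ((F₃.nat 0 rfl).trans e0)
      refine ⟨by simp [applyOps, Op.apply, Store.setNat, f8, f0, add_mul], fun j' hj' x => ?_⟩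
      have e : s₄.natArr 2 (j' * n + x) = (V j').symm x := by
        rcases Nat.lt_succ_iff_lt_or_eq.1 hj' with h | h
        · exact h₄.1 j' h x
        · obtain rfl := Fin.ext h
          exact h₄.2 x (Fin.is_lt _)
      simpa [applyOps, Op.apply, Store.setNat] using e

end RealRAM

namespace RealRAM

/-! ## The table of the values of `f_β` -/

/-- The iterated sums of neighbouring weights: `∑_{j=k}^n β_j * binom(t, j-k)`. -/
noncomputable def binomSum (n : ℕ) (β : ℕ → ℝ) (t k : ℕ) : ℝ :=
  ∑ j ∈ Finset.Icc k n, β j * (t.choose (j - k) : ℝ)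

theorem binomSum_zero {n : ℕ} (β : ℕ → ℝ) {k : ℕ} (hk : k ≤ n) : binomSum n β 0 k = β k := by
  rw [binomSum, Finset.sum_eq_single k]
  · simp
  · intro j hj hne
    have := (Finset.mem_Icc.1 hj).1
    rw [Nat.choose_eq_zero_of_lt (by omega)]
    simp
  · intro h
    exact absurd (Finset.mem_Icc.2 ⟨le_rfl, hk⟩) h

/-- Pascal's rule. It yields all values of `fBeta` by additions alone. -/
theorem binomSum_succ {n : ℕ} (β : ℕ → ℝ) (t : ℕ) {k : ℕ} (hk : k ≤ n) :
    binomSum n β (t + 1) k = binomSum n β t k + binomSum n β t (k + 1) := by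
  simp only [binomSum]
  rw [← Finset.insert_Icc_add_one_left_eq_Icc hk, Finset.sum_insert (by simp),
    Finset.sum_insert (by simp), add_assoc, ← Finset.sum_add_distrib]
  congr 1
  · simp
  · refine Finset.sum_congr rfl fun j hj => ?_
    have := (Finset.mem_Icc.1 hj).1
    obtain ⟨d, rfl⟩ : ∃ d, j = k + 1 + d := ⟨j - (k + 1), by omega⟩
    rw [show k + 1 + d - k = d + 1 by omega, show k + 1 + d - (k + 1) = d by omega,
      Nat.choose_succ_succ]
    push_cast
    ring

/-- Store `f_β(t)` in the cell `t` of the real array `2`. -/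
def fTable : Program :=
  .seq (ops (.natConst 7 0) [])
    (forLoop 7 0 (.seq (ops (.realLoad 2 0 3) [.realStore 2 7 2, .natConst 9 1])
      (forLoop 9 0 (ops (.natAdd 11 9 3) [.realLoad 2 0 9, .realLoad 3 0 11, .realAdd 2 2 3,
        .realStore 0 9 2]))))

/-- The real array `0` is overwritten in place: in round `t` its cell `k` holds `binomSum n γ t k`.
Cell `1` is then the value of `fBeta` at `t`, because the input leaves a `0` in that cell. -/
theorem run_fTable {n : ℕ} {β : ℕ → ℝ} {s : Store} (hn2 : 2 ≤ n) (hn : s.nat 0 = n)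
    (h3 : s.nat 3 = 1) (h1 : s.realArr 0 1 = 0)
    (hβ : ∀ k, 2 ≤ k → k ≤ n → s.realArr 0 k = β k) :
    Run fTable s (n * (n * 7 + 6) + 2) fun s' =>
      ∀ t < n, s'.realArr 2 t = RankAgg.fBeta n β t := by
  set γ := s.realArr 0 with hγ
  have hf : ∀ t, binomSum n γ t 1 = RankAgg.fBeta n β t := fun t => by
    rw [binomSum, RankAgg.fBeta, ← Finset.insert_Icc_add_one_left_eq_Icc (by omega : 1 ≤ n),
      Finset.sum_insert (by simp), h1, zero_mul, zero_add]
    exact Finset.sum_congr rfl fun k hk => by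
      rw [hβ k (Finset.mem_Icc.1 hk).1 (Finset.mem_Icc.1 hk).2]
  -- Cell `n` never changes, so the inner loop may stop at `n - 1`.
  have hlast : ∀ t, binomSum n γ t n = γ n := fun t => by simp [binomSum]
  refine Run.le (T := 1 + ((n - 0) * ((3 + ((n - 1) * (5 + 2) + 1)) + 2) + 1)) ?_ ?_
  swap
  · rw [Nat.sub_zero]
    have : n * (3 + ((n - 1) * (5 + 2) + 1) + 2) ≤ n * (n * 7 + 6) :=
      Nat.mul_le_mul_left _ (by omega)
    omega
  refine Run.seq (Q := fun s' => s'.nat 7 = 0) (Run.ops le_rfl ?_) fun s₁ F₁ h₁ => ?_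
  · simp [applyOps, Op.apply]
  refine Run.mono (Run.forLoop (fun t s' => (∀ k, 1 ≤ k → k ≤ n → s'.realArr 0 k =
    binomSum n γ t k) ∧ ∀ t' < t, s'.realArr 2 t' = RankAgg.fBeta n β t')
    h₁ ((F₁.nat 0 rfl).trans hn) ((F₁.nat 3 rfl).trans h3) (Nat.zero_le _) ?_ ?_)
      le_rfl fun s' _ h => h.2
  · refine ⟨fun k _ hk => ?_, fun t ht => absurd ht (Nat.not_lt_zero _)⟩
    rw [F₁.realArr 0 rfl, binomSum_zero _ hk]
  · intro t s₂ _ ht h7 F₂ ⟨hA, hB⟩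
    have e0 : s₂.nat 0 = n := (F₂.nat 0 rfl).trans ((F₁.nat 0 rfl).trans hn)
    have e3 : s₂.nat 3 = 1 := (F₂.nat 3 rfl).trans ((F₁.nat 3 rfl).trans h3)
    refine Run.seq (Q := fun s' => s'.nat 9 = 1 ∧
      ∀ t' < t + 1, s'.realArr 2 t' = RankAgg.fBeta n β t') (Run.ops le_rfl ?_) fun s₃ F₃ h₃ => ?_
    · refine ⟨by simp [applyOps, Op.apply], fun t' ht' => ?_⟩
      by_cases htt : t' = t
      · subst htt
        simp [applyOps, Op.apply, h7, e3, hA 1 le_rfl (by omega), hf]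
      · simp [applyOps, Op.apply, h7, htt, hB t' (by omega)]
    -- With `k` increasing, cell `k + 1` still holds its old value when it is added to cell `k`.
    refine Run.mono (Run.forLoop (fun k s' => ∀ k', 1 ≤ k' → k' ≤ n → s'.realArr 0 k' =
      if k' < k then binomSum n γ (t + 1) k' else binomSum n γ t k') h₃.1
      ((F₃.nat 0 rfl).trans e0) ((F₃.nat 3 rfl).trans e3) (by omega) ?_ ?_) le_rfl ?_
    · intro k h1 hk
      rw [if_neg (by omega), F₃.realArr 0 rfl, hA k h1 hk]
    · intro k s₄ hk1 hkn h9 F₄ hI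
      have f3 : s₄.nat 3 = 1 := (F₄.nat 3 rfl).trans ((F₃.nat 3 rfl).trans e3)
      refine Run.ops le_rfl fun k' hk1' hkn' => ?_
      by_cases hkk : k' = k
      · subst hkk
        have i1 := hI k' hk1' hkn'
        have i2 := hI (k' + 1) (by omega) (by omega)
        rw [if_neg (by omega)] at i1 i2
        simp [applyOps, Op.apply, Store.setNat, h9, f3, i1, i2, binomSum_succ γ t hkn']
      · have hiff : k' < k + 1 ↔ k' < k := by omega
        simp [applyOps, Op.apply, Store.setNat, h9, hkk, hI k' hk1' hkn', hiff]
    · intro s₄ F₄ hI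
      refine ⟨fun k hk1 hkn => ?_, fun t' ht' => ?_⟩
      · have := hI k hk1 hkn
        rw [Store.setNat, this]
        split_ifs with h
        · rfl
        · obtain rfl : k = n := by omega
          rw [hlast, hlast]
      · rw [Store.setNat, F₄.realArr 2 rfl]
        exact h₃.2 t' ht'

end RealRAM

namespace RealRAM

/-! ## The majority phase -/

/-- The tables that the rest of the program uses. The registers `3` and `19` hold `1` and `0`. -/
structure Tables {n m : ℕ} (V : Fin m → Equiv.Perm (Fin n)) (β : ℕ → ℝ) (μ : Fin n → ℝ)
    (s : Store) : Prop where
  size : s.nat 0 = n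
  voters : s.nat 1 = m
  one : s.nat 3 = 1
  zero : s.nat 19 = 0
  vote : ∀ (j : Fin m) (p : Fin n), s.natArr 0 (j * n + p) = V j p
  pos : ∀ (j : Fin m) (x : Fin n), s.natArr 2 (j * n + x) = (V j).symm x
  weight : ∀ x : Fin n, s.realArr 1 x = μ x
  f : ∀ t < n, s.realArr 2 t = RankAgg.fBeta n β t

/-- The program does not write the tables. -/
def Program.keepsTables (P : Program) : Bool :=
  !(P.anyOp (Op.writesNat 0) || P.anyOp (Op.writesNat 1) || P.anyOp (Op.writesNat 3) ||
    P.anyOp (Op.writesNat 19) || P.anyOp (Op.writesNatArr 0) || P.anyOp (Op.writesNatArr 2) ||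
    P.anyOp (Op.writesRealArr 1) || P.anyOp (Op.writesRealArr 2))

theorem Tables.frame {n m : ℕ} {V : Fin m → Equiv.Perm (Fin n)} {β : ℕ → ℝ} {μ : Fin n → ℝ}
    {s s' : Store} (h : Tables V β μ s) {P : Program} (F : Frame P s s')
    (hP : P.keepsTables = true := by rfl) : Tables V β μ s' := by
  simp only [Program.keepsTables, Bool.not_eq_true', Bool.or_eq_false_iff] at hP
  obtain ⟨⟨⟨⟨⟨⟨⟨h0, h1⟩, h2⟩, h3⟩, h4⟩, h5⟩, h6⟩, h7⟩ := hP
  refine ⟨(F.nat 0 h0).trans h.size, (F.nat 1 h1).trans h.voters, (F.nat 3 h2).trans h.one,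
    (F.nat 19 h3).trans h.zero, ?_, ?_, ?_, ?_⟩
  · rw [F.natArr 0 h4]; exact h.vote
  · rw [F.natArr 2 h5]; exact h.pos
  · rw [F.realArr 1 h6]; exact h.weight
  · rw [F.realArr 2 h7]; exact h.f

/-- The natural array `A` holds the ranking `ω`. -/
def Holds {n : ℕ} (A : ℕ) (ω : Equiv.Perm (Fin n)) (s : Store) : Prop :=
  ∀ p : Fin n, s.natArr A p = ω p

theorem Holds.frame {n : ℕ} {A : ℕ} {ω : Equiv.Perm (Fin n)} {s s' : Store} (h : Holds A ω s)
    {P : Program} (F : Frame P s s') (hP : P.anyOp (Op.writesNatArr A) = false := by rfl) :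
    Holds A ω s' := by
  rw [Holds, F.natArr A hP]
  exact h

/-- Exchange the cells of the natural array `A` whose addresses are in the registers `a` and `b`. -/
def swapCells (A a b : ℕ) : Program :=
  ops (.natLoad 11 A a) [.natLoad 12 A b, .natStore A a 12, .natStore A b 11]

theorem run_swapCells {n A a b : ℕ} {ω : Equiv.Perm (Fin n)} {s : Store}
    (h : Holds A ω s) {p q : Fin n} (hp : s.nat a = p) (hq : s.nat b = q)
    (ha : a ≠ 11 ∧ a ≠ 12 := by decide) (hb : b ≠ 11 ∧ b ≠ 12 := by decide) :
    Run (swapCells A a b) s 4 (Holds A (ω * Equiv.swap p q)) := by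
  refine Run.ops le_rfl fun r => ?_
  have e : (applyOps [.natLoad 11 A a, .natLoad 12 A b, .natStore A a 12, .natStore A b 11]
      s).natArr A r = if (r : ℕ) = q then s.natArr A p else if (r : ℕ) = p then s.natArr A q
        else s.natArr A r := by
    simp [applyOps, Op.apply, Function.update_apply, ha.1, ha.2, hb.1, hb.2, hp, hq]
  rw [e, Equiv.Perm.mul_apply, Equiv.swap_apply_def, h p, h q, h r]
  simp only [Fin.ext_iff]
  split_ifs with h1 h2 h2
  · rw [show p = q from Fin.ext (h2.symm.trans h1)]
  · rfl
  · rfl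
  · rfl

/-- Copy the first `n` cells of the natural array `A` to the natural array `B`. -/
def copyArr (A B : ℕ) : Program :=
  .seq (ops (.natConst 9 0) []) (forLoop 9 0 (ops (.natLoad 11 A 9) [.natStore B 9 11]))

theorem run_copyArr {n A B : ℕ} (hAB : A ≠ B) {ω : Equiv.Perm (Fin n)} {s : Store}
    (hn : s.nat 0 = n) (h3 : s.nat 3 = 1) (h : Holds A ω s) :
    Run (copyArr A B) s (n * 4 + 2) (Holds B ω) := by
  refine Run.le (T := 1 + ((n - 0) * (2 + 2) + 1)) ?_ (by omega)
  refine Run.seq (Q := fun s' => s'.nat 9 = 0) (Run.ops le_rfl ?_) fun s₁ F₁ h₁ => ?_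
  · simp [applyOps, Op.apply]
  refine Run.mono (Run.forLoop (fun k s' => s'.natArr A = s.natArr A ∧
    ∀ p : Fin n, (p : ℕ) < k → s'.natArr B p = ω p) h₁
    ((F₁.nat 0 rfl).trans hn) ((F₁.nat 3 rfl).trans h3) (Nat.zero_le _) ?_ ?_) le_rfl
    fun s' _ h p => h.2 p p.2
  · exact ⟨F₁.natArr A rfl, fun p hp => absurd hp (Nat.not_lt_zero _)⟩
  · rintro k s₂ _ hk h9 F₂ ⟨hA, hI⟩
    lift k to Fin n using hk
    refine Run.ops le_rfl ⟨?_, fun p hp => ?_⟩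
    · simp [applyOps, Op.apply, Store.setNat, hAB, hA]
    · by_cases hpk : p = k
      · subst hpk
        simp [applyOps, Op.apply, Store.setNat, h9, hA, h p]
      · have hpk' := Fin.val_ne_of_ne hpk
        simp [applyOps, Op.apply, Store.setNat, h9, hpk', hI p (by omega)]

/-- Find a position `≥ i` of the candidate that voter `j` likes best among those that the ranking
in the array `3` places at `i` or later. Register `5` holds `i`, register `8` holds `j * n`, and
register `10` receives the position. -/
def voterTop : Program :=
  .seq (ops (.natAdd 10 5 19) [.natAdd 9 5 19])
    (forLoop 9 0 (.seq (ops (.natLoad 11 3 9) [.natLoad 12 3 10, .natAdd 11 8 11, .natAdd 12 8 12,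
        .natLoad 11 2 11, .natLoad 12 2 12])
      (.ite (.natLt 11 12) (ops (.natAdd 10 9 19) []) (ops (.natConst 11 0) []))))

/-- Voter `j` likes the candidate at the position `r ≥ i` of `ω` best among all candidates at
positions `≥ i`. -/
def IsTopFrom {n m : ℕ} (V : Fin m → Equiv.Perm (Fin n)) (ω : Equiv.Perm (Fin n)) (i : ℕ)
    (j : Fin m) (r : Fin n) : Prop :=
  i ≤ r ∧ ∀ r' : Fin n, i ≤ r' → (V j).symm (ω r) ≤ (V j).symm (ω r')

theorem IsTopFrom.unique {n m : ℕ} {V : Fin m → Equiv.Perm (Fin n)} {ω : Equiv.Perm (Fin n)}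
    {i : ℕ} {j : Fin m} {r r' : Fin n} (h : IsTopFrom V ω i j r) (h' : IsTopFrom V ω i j r') :
    r = r' :=
  ω.injective ((V j).symm.injective (le_antisymm (h.2 r' h'.1) (h'.2 r h.1)))

section

variable {n m : ℕ} {V : Fin m → Equiv.Perm (Fin n)} {β : ℕ → ℝ} {μ : Fin n → ℝ} {s : Store}
  {ω : Equiv.Perm (Fin n)}

theorem run_voterTop (hT : Tables V β μ s) (hω : Holds 3 ω s) {i : ℕ} (hi : i < n)
    (h5 : s.nat 5 = i) {j : Fin m} (h8 : s.nat 8 = j * n) :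
    Run voterTop s (n * 10 + 3) fun s' => ∃ r : Fin n, s'.nat 10 = r ∧ IsTopFrom V ω i j r := by
  refine Run.le (T := 2 + ((n - i) * ((6 + (1 + 1)) + 2) + 1)) ?_ (by omega)
  refine Run.seq (Q := fun s' => s'.nat 9 = i ∧ s'.nat 10 = i) (Run.ops le_rfl ?_)
    fun s₁ F₁ h₁ => ?_
  · simp [applyOps, Op.apply, h5, hT.zero]
  refine Run.mono (Run.forLoop (fun k s' => ∃ r : Fin n, s'.nat 10 = r ∧ i ≤ r ∧
    ∀ r' : Fin n, i ≤ r' → (r' : ℕ) < k → (V j).symm (ω r) ≤ (V j).symm (ω r')) h₁.1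
      (hT.frame F₁).size (hT.frame F₁).one hi.le ?_ ?_) le_rfl
      fun s' _ ⟨r, h10, hr, h⟩ => ⟨r, h10, hr, fun r' hr' => h r' hr' r'.2⟩
  · exact ⟨⟨i, hi⟩, h₁.2, le_rfl, fun r' h h' => absurd h' (by omega)⟩
  · rintro k s₂ hik hk h9 F₂ ⟨r, h10, hir, hr⟩
    lift k to Fin n using hk
    have hT₂ := (hT.frame F₁).frame F₂
    have hω₂ := (hω.frame F₁).frame F₂
    have e8 : s₂.nat 8 = j * n := (F₂.nat 8 rfl).trans ((F₁.nat 8 rfl).trans h8)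
    refine Run.seq (Q := fun s' => s'.nat 11 = (V j).symm (ω k) ∧ s'.nat 12 = (V j).symm (ω r))
      (Run.ops le_rfl ?_) fun s₃ F₃ h₃ => ?_
    · simp [applyOps, Op.apply, h9, h10, e8, hω₂ k, hω₂ r, hT₂.pos]
    have e9 : s₃.nat 9 = k := (F₃.nat 9 rfl).trans h9
    have e10 : s₃.nat 10 = r := (F₃.nat 10 rfl).trans h10
    refine Run.ite (fun hlt => ?_) (fun hlt => ?_)
    · have hlt' : ((V j).symm (ω k) : ℕ) < (V j).symm (ω r) := by
        have : s₃.nat 11 < s₃.nat 12 := hlt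
        rwa [h₃.1, h₃.2] at this
      refine Run.ops le_rfl ⟨k, ?_, hik, fun r' h1 h2 => ?_⟩
      · simp [applyOps, Op.apply, Store.setNat, e9, (hT₂.frame F₃).zero]
      · rcases Nat.lt_succ_iff_lt_or_eq.1 h2 with h | h
        · exact hlt'.le.trans (hr r' h1 h)
        · rw [Fin.ext h]
    · have hlt' : ((V j).symm (ω r) : ℕ) ≤ (V j).symm (ω k) := by
        have : ¬ s₃.nat 11 < s₃.nat 12 := hlt
        rw [h₃.1, h₃.2] at this
        omega
      refine Run.ops le_rfl ⟨r, ?_, hir, fun r' h1 h2 => ?_⟩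
      · simp [applyOps, Op.apply, Store.setNat, e10]
      · rcases Nat.lt_succ_iff_lt_or_eq.1 h2 with h | h
        · exact hr r' h1 h
        · rw [Fin.ext h]
          exact hlt'

/-- Count in the cell `r` of the natural array `4` the voters whose favourite from position `i` on
is at position `r`. -/
def countTops : Program :=
  .seq (ops (.natConst 9 0) []) (.seq (forLoop 9 0 (ops (.natStore 4 9 19) []))
    (.seq (ops (.natConst 7 0) [.natConst 8 0]) (forLoop 7 1 (.seq voterTop
      (ops (.natLoad 11 4 10) [.natAdd 11 11 3, .natStore 4 10 11, .natAdd 8 8 0])))))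

open Classical in
-- By `IsTopFrom.unique` each voter raises exactly one counter.
theorem run_countTops (hT : Tables V β μ s) (hω : Holds 3 ω s) {i : ℕ} (hi : i < n)
    (h5 : s.nat 5 = i) :
    Run countTops s (n * 3 + m * (n * 10 + 9) + 5) fun s' => ∀ r : Fin n,
      s'.natArr 4 r = (Finset.univ.filter fun j : Fin m => IsTopFrom V ω i j r).card := by
  refine Run.le (T := 1 + (((n - 0) * (1 + 2) + 1) + (2 + ((m - 0) * (((n * 10 + 3) + 4) + 2) + 1))))
    ?_ (by rw [Nat.sub_zero, Nat.sub_zero]; apply le_of_eq; ring)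
  refine Run.seq (Q := fun s' => s'.nat 9 = 0) (Run.ops le_rfl ?_) fun s₁ F₁ h₁ => ?_
  · simp [applyOps, Op.apply]
  have hT₁ := hT.frame F₁
  refine Run.seq (Run.forLoop (fun k s' => ∀ r < k, s'.natArr 4 r = 0) h₁ hT₁.size hT₁.one
    (Nat.zero_le _) ?_ ?_) fun s₂ F₂ h₂ => ?_
  · exact fun r hr => absurd hr (Nat.not_lt_zero _)
  · intro k s' _ hk h9 F' hI
    refine Run.ops le_rfl fun r hr => ?_
    by_cases hrk : r = k
    · subst hrk
      simp [applyOps, Op.apply, Store.setNat, h9, (hT₁.frame F').zero]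
    · simp [applyOps, Op.apply, Store.setNat, h9, hrk, hI r (by omega)]
  have hT₂ := hT₁.frame F₂
  refine Run.seq (Q := fun s' => s'.nat 7 = 0 ∧ s'.nat 8 = 0) (Run.ops le_rfl ?_) fun s₃ F₃ h₃ => ?_
  · simp [applyOps, Op.apply]
  have hT₃ := hT₂.frame F₃
  refine Run.mono (Run.forLoop (fun j s' => s'.nat 8 = j * n ∧ ∀ r : Fin n, s'.natArr 4 r =
    (Finset.univ.filter fun j' : Fin m => (j' : ℕ) < j ∧ IsTopFrom V ω i j' r).card) h₃.1
    hT₃.voters hT₃.one (Nat.zero_le _) ?_ ?_) le_rfl fun s' _ h r => ?_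
  · refine ⟨by simp [h₃.2], fun r => ?_⟩
    rw [F₃.natArr 4 rfl, h₂ r r.2]
    simp
  · rintro j s₄ _ hj h7 F₄ ⟨h8, hI⟩
    lift j to Fin m using hj
    have e5 : s₄.nat 5 = i := by
      rw [F₄.nat 5 rfl, F₃.nat 5 rfl, F₂.nat 5 rfl, F₁.nat 5 rfl, h5]
    refine Run.seq (T := n * 10 + 3) (T' := 4) (run_voterTop (hT₃.frame F₄)
      ((((hω.frame F₁).frame F₂).frame F₃).frame F₄) hi e5 h8) ?_
    rintro s₅ F₅ ⟨b, h10, hb⟩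
    have hT₅ := (hT₃.frame F₄).frame F₅
    have e8 : s₅.nat 8 = j * n := (F₅.nat 8 rfl).trans h8
    have e4 : s₅.natArr 4 = s₄.natArr 4 := F₅.natArr 4 rfl
    refine Run.ops le_rfl ⟨?_, fun r => ?_⟩
    · simp [applyOps, Op.apply, Store.setNat, e8, hT₅.size, add_mul]
    · have hfilter : (Finset.univ.filter fun j' : Fin m =>
          (j' : ℕ) < j + 1 ∧ IsTopFrom V ω i j' r) =
          (Finset.univ.filter fun j' : Fin m => (j' : ℕ) < j ∧ IsTopFrom V ω i j' r) ∪
          (if r = b then {j} else ∅) := by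
        ext j'
        simp only [Finset.mem_filter, Finset.mem_univ, true_and, Finset.mem_union]
        by_cases hjj : j' = j
        · subst hjj
          have : IsTopFrom V ω i j' r ↔ r = b := ⟨fun h => h.unique hb, fun h => h ▸ hb⟩
          rw [this]
          by_cases hrb : r = b <;> simp [hrb]
        · have h1 := Fin.val_ne_of_ne hjj
          have h2 : j' ∉ (if r = b then {j} else ∅ : Finset (Fin m)) := by
            split_ifs <;> simp [hjj]
          have h3 : (j' : ℕ) < j + 1 ↔ (j' : ℕ) < j := by omega
          simp [h2, h3]
      rw [hfilter, Finset.card_union_of_disjoint, ← hI r]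
      · by_cases hrb : r = b
        · subst hrb
          simp [applyOps, Op.apply, Store.setNat, h10, hT₅.one, e4]
        · have hrb' : (r : ℕ) ≠ b := Fin.val_ne_of_ne hrb
          simp [applyOps, Op.apply, Store.setNat, h10, hrb, hrb', e4]
      · rw [Finset.disjoint_left]
        intro j' h1 h2
        rw [Finset.mem_filter] at h1
        split_ifs at h2
        · rw [Finset.mem_singleton.1 h2] at h1
          exact lt_irrefl _ h1.2.1
        · simp at h2
  · rw [h.2 r]
    simp

/-- Search the natural array `4` from position `i` on for a count of more than `m / 2`; register
`22` receives its position, or `n`. -/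
def findMajority : Program :=
  .seq (ops (.natAdd 22 0 19) [.natAdd 9 5 19])
    (forLoop 9 0 (.seq (ops (.natLoad 11 4 9) [.natAdd 11 11 11])
      (.ite (.natLt 1 11) (ops (.natAdd 22 9 19) []) (ops (.natConst 11 0) []))))

theorem run_findMajority (hT : Tables V β μ s) {i : ℕ} (hi : i < n)
    (h5 : s.nat 5 = i) :
    Run findMajority s (n * 6 + 3) fun s' =>
      (s'.nat 22 = n ∧ ∀ r : Fin n, i ≤ r → s.natArr 4 r + s.natArr 4 r ≤ m) ∨
      ∃ r : Fin n, s'.nat 22 = r ∧ i ≤ r ∧ m < s.natArr 4 r + s.natArr 4 r := by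
  refine Run.le (T := 2 + ((n - i) * ((2 + (1 + 1)) + 2) + 1)) ?_ (by omega)
  refine Run.seq (Q := fun s' => s'.nat 9 = i ∧ s'.nat 22 = n) (Run.ops le_rfl ?_)
    fun s₁ F₁ h₁ => ?_
  · simp [applyOps, Op.apply, h5, hT.zero, hT.size]
  have hT₁ := hT.frame F₁
  refine Run.mono (Run.forLoop (fun k s' =>
    (s'.nat 22 = n ∧ ∀ r : Fin n, i ≤ r → (r : ℕ) < k → s.natArr 4 r + s.natArr 4 r ≤ m) ∨
      ∃ r : Fin n, s'.nat 22 = r ∧ i ≤ r ∧ m < s.natArr 4 r + s.natArr 4 r) h₁.1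
      hT₁.size hT₁.one hi.le ?_ ?_) le_rfl
      fun s' _ h => h.imp_left fun h => ⟨h.1, fun r hr => h.2 r hr r.2⟩
  · exact Or.inl ⟨h₁.2, fun r h h' => absurd h' (by omega)⟩
  · rintro k s₂ hik hk h9 F₂ hI
    lift k to Fin n using hk
    have hT₂ := hT₁.frame F₂
    have e4 : s₂.natArr 4 = s.natArr 4 := (F₂.natArr 4 rfl).trans (F₁.natArr 4 rfl)
    refine Run.seq (Q := fun s' => s'.nat 11 = s.natArr 4 k + s.natArr 4 k)
      (Run.ops le_rfl ?_) fun s₃ F₃ h₃ => ?_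
    · simp [applyOps, Op.apply, h9, e4]
    have hT₃ := hT₂.frame F₃
    have e9 : s₃.nat 9 = k := (F₃.nat 9 rfl).trans h9
    refine Run.ite (fun hlt => ?_) (fun hlt => ?_)
    · have hlt' : s₃.nat 1 < s₃.nat 11 := hlt
      rw [h₃, hT₃.voters] at hlt'
      refine Run.ops le_rfl (Or.inr ⟨k, ?_, hik, hlt'⟩)
      simp [applyOps, Op.apply, Store.setNat, e9, hT₃.zero]
    · have hlt' : ¬ s₃.nat 1 < s₃.nat 11 := hlt
      rw [h₃, hT₃.voters, not_lt] at hlt'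
      have e22 : ((applyOps [.natConst 11 0] s₃).setNat 9 (k + 1)).nat 22 = s₂.nat 22 := by
        simp [applyOps, Op.apply, Store.setNat, F₃.nat 22 rfl]
      refine Run.ops le_rfl ?_
      rw [e22]
      refine hI.imp_left fun h => ⟨h.1, fun r h1 h2 => ?_⟩
      rcases Nat.lt_succ_iff_lt_or_eq.1 h2 with h' | h'
      · exact h.2 r h1 h'
      · rw [Fin.ext h']
        exact hlt'

end

end RealRAM

/-! ### States of the while-loop, encoded by a permutation and the number of placed candidates -/

namespace RankAgg

/-- The candidates that `ω` places at the positions `< i`, best first. -/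
def placed {n : ℕ} (ω : Equiv.Perm (Fin n)) (i : ℕ) : List (Fin n) := (List.ofFn ω).take i

/-- The candidates that `ω` places at the positions `≥ i`. -/
def remaining {n : ℕ} (ω : Equiv.Perm (Fin n)) (i : ℕ) : Finset (Fin n) :=
  Finset.univ.filter fun x => i ≤ (ω.symm x : ℕ)

theorem length_placed {n : ℕ} (ω : Equiv.Perm (Fin n)) {i : ℕ} (hi : i ≤ n) :
    (placed ω i).length = i := by
  simp [placed, hi]

theorem startsWith_placed_iff {n : ℕ} {ω ω' : Equiv.Perm (Fin n)} {i : ℕ} (hi : i ≤ n) :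
    StartsWith ω' (placed ω i) ↔ AgreeBelow i ω' ω := by
  refine forall_congr' fun p => ?_
  simp only [length_placed ω hi]
  simp only [placed, List.getElem_take, List.getElem_ofFn, Fin.eta]

theorem mem_remaining {n : ℕ} {ω : Equiv.Perm (Fin n)} {i : ℕ} {x : Fin n} :
    x ∈ remaining ω i ↔ i ≤ (ω.symm x : ℕ) := by
  simp [remaining]

theorem placed_zero {n : ℕ} (ω : Equiv.Perm (Fin n)) : placed ω 0 = [] := rfl

theorem remaining_zero {n : ℕ} (ω : Equiv.Perm (Fin n)) : remaining ω 0 = Finset.univ := by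
  simp [remaining]

/-- One exchange performs a round of the while-loop. It disturbs the order of the later candidates,
but only their set matters. -/
theorem placed_mul_swap {n : ℕ} (ω : Equiv.Perm (Fin n)) {p r : Fin n} (hpr : p ≤ r) :
    placed (ω * Equiv.swap p r) (p + 1) = placed ω p ++ [ω r] := by
  have hp := p.2
  refine List.ext_getElem (by simp [placed]) fun q h1 h2 => ?_
  rw [length_placed _ hp] at h1
  by_cases hq : q < p
  · rw [List.getElem_append_left (by rwa [length_placed _ hp.le])]
    simp only [placed, List.getElem_take, List.getElem_ofFn, Equiv.Perm.mul_apply]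
    rw [Equiv.swap_apply_of_ne_of_ne] <;>
    · intro h
      rw [Fin.ext_iff] at h
      rw [Fin.le_def] at hpr
      simp only at h
      omega
  · obtain rfl : q = p := by omega
    rw [List.getElem_append_right (by rw [length_placed _ hp.le])]
    simp [placed]

theorem remaining_mul_swap {n : ℕ} (ω : Equiv.Perm (Fin n)) {p r : Fin n} (hpr : p ≤ r) :
    remaining (ω * Equiv.swap p r) (p + 1) = (remaining ω p).erase (ω r) := by
  ext x
  rw [Finset.mem_erase, mem_remaining, mem_remaining]
  have h1 : (ω * Equiv.swap p r).symm x = Equiv.swap p r (ω.symm x) := by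
    rw [Equiv.symm_apply_eq, Equiv.Perm.mul_apply, Equiv.swap_apply_self, Equiv.apply_symm_apply]
  have h2 : x ≠ ω r ↔ ω.symm x ≠ r := by rw [not_iff_not, Equiv.symm_apply_eq]
  rw [h1, h2, Equiv.swap_apply_def]
  rw [Fin.le_def] at hpr
  simp only [ne_eq, Fin.ext_iff]
  split_ifs <;> omega

open Classical in
-- Doubling the count replaces the real number `m / 2` by a comparison that the machine can make on
-- naturals.
theorem isMajority_remaining_iff {n m : ℕ} {V : Fin m → Equiv.Perm (Fin n)}
    {ω : Equiv.Perm (Fin n)} {i : ℕ} {r : Fin n} (hr : i ≤ r) :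
    IsMajority V (remaining ω i) (ω r) ↔
      m < (Finset.univ.filter fun j : Fin m => RealRAM.IsTopFrom V ω i j r).card +
        (Finset.univ.filter fun j : Fin m => RealRAM.IsTopFrom V ω i j r).card := by
  have e : (Finset.univ.filter fun j : Fin m => ∀ a ∈ (remaining ω i).erase (ω r),
      Prefers (V j) (ω r) a) = Finset.univ.filter fun j : Fin m => RealRAM.IsTopFrom V ω i j r := by
    refine Finset.filter_congr fun j _ => ⟨fun h => ⟨hr, fun r' hr' => ?_⟩, fun h a ha => ?_⟩
    · by_cases hrr : r' = r
      · rw [hrr]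
      · exact (h (ω r') (Finset.mem_erase.2 ⟨fun h => hrr (ω.injective h),
          mem_remaining.2 (by rwa [Equiv.symm_apply_apply])⟩)).le
    · rw [Finset.mem_erase, mem_remaining] at ha
      have h1 := h.2 _ ha.2
      rw [Equiv.apply_symm_apply] at h1
      exact lt_of_le_of_ne h1 fun h2 => ha.1 ((V j).symm.injective h2).symm
  rw [IsMajority, e, mem_remaining, Equiv.symm_apply_apply, and_iff_right hr, div_lt_iff₀ two_pos,
    mul_two]
  exact_mod_cast Iff.rfl

end RankAgg

/-! ### The while-loop as a program -/

namespace RealRAM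

/-- Store the identity in the natural array `3`, and set the registers `4` and `5` to `n` and `0`. -/
def initRanking : Program :=
  .seq (ops (.natConst 9 0) [.natAdd 4 0 19, .natConst 5 0])
    (forLoop 9 0 (ops (.natStore 3 9 9) []))

/-- The while-loop of the algorithm. -/
def majorityLoop : Program :=
  .loop (.natLt 5 4) (.seq countTops (.seq findMajority (.ite (.natLt 22 0)
    (.seq (swapCells 3 5 22) (ops (.natAdd 5 5 3) [])) (ops (.natConst 4 0) []))))

section

variable {n m : ℕ} {V : Fin m → Equiv.Perm (Fin n)} {β : ℕ → ℝ} {μ : Fin n → ℝ} {s : Store}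

theorem run_initRanking (hT : Tables V β μ s) :
    Run initRanking s (n * 3 + 4) fun s' =>
      Holds 3 (1 : Equiv.Perm (Fin n)) s' ∧ s'.nat 4 = n ∧ s'.nat 5 = 0 := by
  refine Run.le (T := 3 + ((n - 0) * (1 + 2) + 1)) ?_ (by omega)
  refine Run.seq (Q := fun s' => s'.nat 9 = 0 ∧ s'.nat 4 = n ∧ s'.nat 5 = 0) (Run.ops le_rfl ?_)
    fun s₁ F₁ h₁ => ?_
  · simp [applyOps, Op.apply, hT.size, hT.zero]
  have hT₁ := hT.frame F₁
  refine Run.mono (Run.forLoop (fun k s' => ∀ p < k, s'.natArr 3 p = p) h₁.1 hT₁.size hT₁.one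
    (Nat.zero_le _) ?_ ?_) le_rfl fun s' F h => ⟨fun p => ?_, ?_, ?_⟩
  · exact fun p hp => absurd hp (Nat.not_lt_zero _)
  · intro k s₂ _ hk h9 F₂ hI
    refine Run.ops le_rfl fun p hp => ?_
    by_cases hpk : p = k
    · subst hpk
      simp [applyOps, Op.apply, Store.setNat, h9]
    · simp [applyOps, Op.apply, Store.setNat, h9, hpk, hI p (by omega)]
  · rw [h p p.2]
    rfl
  · rw [F.nat 4 rfl, h₁.2.1]
  · rw [F.nat 5 rfl, h₁.2.2]

/-- Register `4` is both bound and stop flag: it holds `n` until a search fails and `0` afterwards,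
so its excess over register `5` is a variant. If the loop ends with `i = n`, no candidate remains,
and hence none has a majority. -/
theorem run_majorityLoop (hT : Tables V β μ s) (hω : Holds 3 (1 : Equiv.Perm (Fin n)) s)
    (h4 : s.nat 4 = n) (h5 : s.nat 5 = 0) :
    Run majorityLoop s (n * (n * 9 + m * (n * 10 + 9) + 15) + 1) fun s' =>
      ∃ (ω : Equiv.Perm (Fin n)) (i : ℕ), Holds 3 ω s' ∧ s'.nat 5 = i ∧ i ≤ n ∧
        RankAgg.LoopReaches V (RankAgg.placed ω i) (RankAgg.remaining ω i) ∧
        ¬ ∃ c, RankAgg.IsMajority V (RankAgg.remaining ω i) c := by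
  classical
  have key := Run.loop (b := .natLt 5 4) (P := .seq countTops (.seq findMajority
      (.ite (.natLt 22 0) (.seq (swapCells 3 5 22) (ops (.natAdd 5 5 3) []))
      (ops (.natConst 4 0) []))))
    (T := (n * 3 + m * (n * 10 + 9) + 5) + ((n * 6 + 3) + ((4 + 1) + 1)))
    (Q := fun s' => ∃ (ω : Equiv.Perm (Fin n)) (i : ℕ), Holds 3 ω s' ∧ s'.nat 5 = i ∧ i ≤ n ∧
        RankAgg.LoopReaches V (RankAgg.placed ω i) (RankAgg.remaining ω i) ∧
        ¬ ∃ c, RankAgg.IsMajority V (RankAgg.remaining ω i) c)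
    (fun v s' => Tables V β μ s' ∧ v = s'.nat 4 - s'.nat 5 ∧
      ∃ (ω : Equiv.Perm (Fin n)) (i : ℕ), Holds 3 ω s' ∧ s'.nat 5 = i ∧ i ≤ n ∧
        RankAgg.LoopReaches V (RankAgg.placed ω i) (RankAgg.remaining ω i) ∧
        (s'.nat 4 = n ∨ s'.nat 4 = 0 ∧ ¬ ∃ c, RankAgg.IsMajority V (RankAgg.remaining ω i) c))
    ?_ ?_ n s ⟨hT, by rw [h4, h5, Nat.sub_zero], 1, 0, hω, h5, Nat.zero_le _, ?_, Or.inl h4⟩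
  · refine key.le ?_
    apply le_of_eq
    ring
  · rintro v s₁ ⟨hT₁, rfl, ω, i, hω₁, h5₁, hi, hl, hlim⟩ hlt
    have hlt' : s₁.nat 5 < s₁.nat 4 := hlt
    have h4₁ : s₁.nat 4 = n := by
      rcases hlim with h | h
      · exact h
      · omega
    have hin : i < n := by omega
    refine Run.seq (run_countTops hT₁ hω₁ hin h5₁) fun s₂ F₂ h₂ => ?_
    have hT₂ := hT₁.frame F₂
    have h5₂ : s₂.nat 5 = i := (F₂.nat 5 rfl).trans h5₁
    refine Run.seq (run_findMajority hT₂ hin h5₂) fun s₃ F₃ h₃ => ?_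
    have hT₃ := hT₂.frame F₃
    have h5₃ : s₃.nat 5 = i := (F₃.nat 5 rfl).trans h5₂
    have h4₃ : s₃.nat 4 = n := (F₃.nat 4 rfl).trans ((F₂.nat 4 rfl).trans h4₁)
    have hω₃ := (hω₁.frame F₂).frame F₃
    refine Run.ite (fun hlt3 => ?_) (fun hlt3 => ?_)
    · have hlt3' : s₃.nat 22 < s₃.nat 0 := hlt3
      rcases h₃ with ⟨h22, _⟩ | ⟨r, h22, hir, hr⟩
      · rw [h22, hT₃.size] at hlt3'
        omega
      have hmaj : RankAgg.IsMajority V (RankAgg.remaining ω i) (ω r) := by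
        rw [RankAgg.isMajority_remaining_iff hir, ← h₂ r]
        exact hr
      lift i to Fin n using hin
      refine Run.seq (run_swapCells hω₃ h5₃ h22) fun s₄ F₄ h₄ => Run.ops le_rfl ?_
      have hT₄ := hT₃.frame F₄
      have h4₄ : s₄.nat 4 = n := (F₄.nat 4 rfl).trans h4₃
      have h5₄ : s₄.nat 5 = i := (F₄.nat 5 rfl).trans h5₃
      have e5 : (applyOps [.natAdd 5 5 3] s₄).nat 5 = i + 1 := by
        simp [applyOps, Op.apply, h5₄, hT₄.one]
      have e4 : (applyOps [.natAdd 5 5 3] s₄).nat 4 = n := by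
        simp [applyOps, Op.apply, h4₄]
      have F₅ : Frame _ s₄ (applyOps [.natAdd 5 5 3] s₄) := frame_op (.natAdd 5 5 3) s₄
      refine ⟨_, ?_, hT₄.frame F₅, rfl, ω * Equiv.swap i r, i + 1, h₄.frame F₅, e5, i.2, ?_,
        Or.inl e4⟩
      · rw [e4, e5, h4₁, h5₁]
        omega
      · rw [RankAgg.placed_mul_swap ω hir, RankAgg.remaining_mul_swap ω hir]
        exact hl.step hmaj
    · have hlt3' : ¬ s₃.nat 22 < s₃.nat 0 := hlt3
      rw [hT₃.size] at hlt3'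
      have hno : ¬ ∃ c, RankAgg.IsMajority V (RankAgg.remaining ω i) c := by
        rintro ⟨c, hc⟩
        have hic := RankAgg.mem_remaining.1 hc.1
        rcases h₃ with ⟨h22, h⟩ | ⟨r, h22, _⟩
        · have h1 := h _ hic
          rw [h₂, ← not_lt, ← RankAgg.isMajority_remaining_iff hic, Equiv.apply_symm_apply] at h1
          exact h1 hc
        · have := r.2
          omega
      refine Run.ops (by simp) ?_
      have e5 : (applyOps [.natConst 4 0] s₃).nat 5 = i := by
        simp [applyOps, Op.apply, h5₃]
      have e4 : (applyOps [.natConst 4 0] s₃).nat 4 = 0 := by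
        simp [applyOps, Op.apply]
      have F₄ : Frame _ s₃ (applyOps [.natConst 4 0] s₃) := frame_op (.natConst 4 0) s₃
      refine ⟨_, ?_, hT₃.frame F₄, rfl, ω, i, hω₃.frame F₄, e5, hi, hl, Or.inr ⟨e4, hno⟩⟩
      rw [e4, e5]
      omega
  · rintro v s₁ ⟨hT₁, rfl, ω, i, hω₁, h5₁, hi, hl, hlim⟩ hlt
    have hlt' : ¬ s₁.nat 5 < s₁.nat 4 := hlt
    refine ⟨ω, i, hω₁, h5₁, hi, hl, ?_⟩
    rcases hlim with h | h
    · rintro ⟨c, hc⟩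
      have := RankAgg.mem_remaining.1 hc.1
      omega
    · exact h.2
  · rw [RankAgg.placed_zero, RankAgg.remaining_zero]
    exact .start

end

end RealRAM

namespace RealRAM

/-! ## Evaluation of a ranking -/

theorem sum_filter_val_lt_succ {N : ℕ} {M : Type*} [AddCommMonoid M] (f : Fin N → M) (k : Fin N) :
    ∑ j ∈ Finset.univ.filter (fun j : Fin N => (j : ℕ) < k + 1), f j =
      ∑ j ∈ Finset.univ.filter (fun j : Fin N => (j : ℕ) < k), f j + f k := by
  have : Finset.univ.filter (fun j : Fin N => (j : ℕ) < k + 1) =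
      insert k (Finset.univ.filter (fun j : Fin N => (j : ℕ) < k)) := by
    ext j
    simp only [Finset.mem_filter, Finset.mem_univ, true_and, Finset.mem_insert, Fin.ext_iff]
    omega
  rw [this, Finset.sum_insert (by simp), add_comm]

/-- Count in register `10` the candidates that voter `j` places below the candidate in register `24`
among those that the ranking in the array `6` places below the position in register `20`. Register
`8` holds `j * n`. -/
def countBelow : Program :=
  .seq (ops (.natAdd 11 8 24) [.natLoad 25 2 11, .natConst 10 0, .natAdd 9 20 3])
    (forLoop 9 0 (.seq (ops (.natLoad 11 6 9) [.natAdd 11 8 11, .natLoad 11 2 11])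
      (.ite (.natLt 25 11) (ops (.natAdd 10 10 3) []) (ops (.natConst 11 0) []))))

/-- Add to the real register `0` the terms of voter `j` for the position `p` in register `20`; the
real registers `2` and `3` hold `f_β(n-(p+1))` and the weight of the candidate at `p`. -/
def addTerm : Program :=
  .seq countBelow (ops (.natAdd 11 8 20) [.natLoad 11 0 11, .realLoad 4 1 11, .realAdd 4 3 4,
    .realMul 4 2 4, .realAdd 0 0 4, .realLoad 4 2 10, .realMul 4 4 3, .realSub 0 0 4,
    .realSub 0 0 4, .natAdd 8 8 0])

/-- Store in the real register `0` the truncated distance of the ranking in the array `6` to the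
profile for the positions from register `5` to register `6`. -/
def evalRanking : Program :=
  .seq (ops (.realConst 0 0) [.natAdd 20 5 19])
    (forLoop 20 6 (.seq (ops (.natLoad 24 6 20) [.natSub 11 0 20, .natSub 11 11 3, .realLoad 2 2 11,
      .realLoad 3 1 24, .natConst 7 0, .natConst 8 0]) (forLoop 7 1 addTerm)))

/-- The distance of `ω` to the profile, truncated to the positions `p` with `i ≤ p < e`. -/
noncomputable def windowCost {n m : ℕ} (V : Fin m → Equiv.Perm (Fin n)) (β : ℕ → ℝ) (μ : Fin n → ℝ)
    (ω : Equiv.Perm (Fin n)) (i e : ℕ) : ℝ :=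
  ∑ p ∈ Finset.univ.filter (fun p : Fin n => (p : ℕ) < e),
    if i ≤ p then ∑ j, RankAgg.posTerm β μ ω (V j) p else 0

theorem windowCost_eq {n m : ℕ} (V : Fin m → Equiv.Perm (Fin n)) (β : ℕ → ℝ) (μ : Fin n → ℝ)
    (ω : Equiv.Perm (Fin n)) (i e : ℕ) :
    windowCost V β μ ω i e = RankAgg.profileTruncDist β μ ω V (i + 1) e := by
  simp only [windowCost, RankAgg.profileTruncDist, RankAgg.truncDist_eq]
  rw [Finset.sum_comm, ← Finset.sum_filter, Finset.filter_filter]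
  refine Finset.sum_congr (Finset.filter_congr fun p _ => ?_) fun _ _ => rfl
  omega

section

variable {n m : ℕ} {V : Fin m → Equiv.Perm (Fin n)} {β : ℕ → ℝ} {μ : Fin n → ℝ} {s : Store}
  {ω : Equiv.Perm (Fin n)}

/-- Starting at `p + 1` leaves only the voter's preference to test; `ω` maps the counted positions
bijectively onto the intersection. -/
theorem run_countBelow (hT : Tables V β μ s) (hω : Holds 6 ω s) {j : Fin m} {p : Fin n}
    (h8 : s.nat 8 = j * n) (h20 : s.nat 20 = p) (h24 : s.nat 24 = ω p) :
    Run countBelow s (n * 7 + 5) fun s' =>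
      s'.nat 10 = (RankAgg.below ω (ω p) ∩ RankAgg.below (V j) (ω p)).card := by
  have hp := p.2
  refine Run.le (T := 4 + ((n - (p + 1)) * ((3 + (1 + 1)) + 2) + 1)) ?_ (by omega)
  refine Run.seq (Q := fun s' => s'.nat 9 = p + 1 ∧ s'.nat 10 = 0 ∧
    s'.nat 25 = (V j).symm (ω p)) (Run.ops le_rfl ?_) fun s₁ F₁ h₁ => ?_
  · simp [applyOps, Op.apply, h8, h20, h24, hT.one, hT.pos]
  have hT₁ := hT.frame F₁
  refine Run.mono (Run.forLoop (fun k s' => s'.nat 10 = (Finset.univ.filter fun r : Fin n =>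
    (r : ℕ) < k ∧ p < r ∧ (V j).symm (ω p) < (V j).symm (ω r)).card) h₁.1 hT₁.size hT₁.one hp
    ?_ ?_) le_rfl fun s' _ h => ?_
  · rw [h₁.2.1, eq_comm, Finset.card_eq_zero, Finset.filter_eq_empty_iff]
    rintro r - ⟨h1, h2, -⟩
    rw [Fin.lt_def] at h2
    omega
  · intro k s₂ hpk hk h9 F₂ hI
    lift k to Fin n using hk
    have hT₂ := hT₁.frame F₂
    have hω₂ := (hω.frame F₁).frame F₂
    have e8 : s₂.nat 8 = j * n := (F₂.nat 8 rfl).trans ((F₁.nat 8 rfl).trans h8)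
    refine Run.seq (Q := fun s' => s'.nat 11 = (V j).symm (ω k)) (Run.ops le_rfl ?_)
      fun s₃ F₃ h₃ => ?_
    · simp [applyOps, Op.apply, h9, hω₂ k, e8, hT₂.pos]
    have hT₃ := hT₂.frame F₃
    have e10 := (F₃.nat 10 rfl).trans hI
    have e25 : s₃.nat 25 = (V j).symm (ω p) :=
      (F₃.nat 25 rfl).trans ((F₂.nat 25 rfl).trans h₁.2.2)
    have hcard : (Finset.univ.filter fun r : Fin n => (r : ℕ) < k + 1 ∧ p < r ∧
        (V j).symm (ω p) < (V j).symm (ω r)).card = (Finset.univ.filter fun r : Fin n =>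
        (r : ℕ) < k ∧ p < r ∧ (V j).symm (ω p) < (V j).symm (ω r)).card +
        if (V j).symm (ω p) < (V j).symm (ω k) then 1 else 0 := by
      have hpk' : p < k := hpk
      have h (K : ℕ) : (Finset.univ.filter fun r : Fin n => (r : ℕ) < K ∧ p < r ∧
          (V j).symm (ω p) < (V j).symm (ω r)).card = ∑ r ∈ Finset.univ.filter
          (fun r : Fin n => (r : ℕ) < K),
          if p < r ∧ (V j).symm (ω p) < (V j).symm (ω r) then 1 else 0 := by
        rw [← Finset.filter_filter, Finset.card_filter]
      rw [h, h, sum_filter_val_lt_succ]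
      simp only [hpk', true_and]
    refine Run.ite (fun hlt => ?_) (fun hlt => ?_)
    · have hlt' : (V j).symm (ω p) < (V j).symm (ω k) := by
        have : s₃.nat 25 < s₃.nat 11 := hlt
        rwa [e25, h₃] at this
      refine Run.ops le_rfl ?_
      rw [hcard, if_pos hlt']
      simp [applyOps, Op.apply, Store.setNat, e10, hT₃.one]
    · have hlt' : ¬ (V j).symm (ω p) < (V j).symm (ω k) := by
        have : ¬ s₃.nat 25 < s₃.nat 11 := hlt
        rwa [e25, h₃] at this
      refine Run.ops le_rfl ?_
      rw [hcard, if_neg hlt']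
      simp [applyOps, Op.apply, Store.setNat, e10]
  · rw [h]
    have : RankAgg.below ω (ω p) ∩ RankAgg.below (V j) (ω p) = (Finset.univ.filter
        fun r : Fin n => (r : ℕ) < n ∧ p < r ∧ (V j).symm (ω p) < (V j).symm (ω r)).map
        ω.toEmbedding := by
      ext x
      simp [RankAgg.mem_below, Finset.mem_map_equiv]
    rw [this, Finset.card_map]

/-- Two subtractions realise the factor `2` in `posTerm`. The table covers the lookup since the
intersection has fewer than `n` elements. -/
theorem run_addTerm (hT : Tables V β μ s) (hω : Holds 6 ω s) {j : Fin m} {p : Fin n}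
    (h8 : s.nat 8 = j * n) (h20 : s.nat 20 = p) (h24 : s.nat 24 = ω p)
    (h2 : s.real 2 = RankAgg.fBeta n β (n - (p + 1))) (h3 : s.real 3 = μ (ω p)) :
    Run addTerm s (n * 7 + 5 + 11) fun s' => s'.nat 8 = (j + 1) * n ∧
      s'.real 0 = s.real 0 + RankAgg.posTerm β μ ω (V j) p := by
  refine Run.seq (run_countBelow hT hω h8 h20 h24) fun s₁ F₁ h₁ => Run.ops le_rfl ?_
  have hT₁ := hT.frame F₁
  have e8 : s₁.nat 8 = j * n := (F₁.nat 8 rfl).trans h8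
  have e20 : s₁.nat 20 = p := (F₁.nat 20 rfl).trans h20
  have r0 : s₁.real 0 = s.real 0 := F₁.real 0 rfl
  have r2 := (F₁.real 2 rfl).trans h2
  have r3 := (F₁.real 3 rfl).trans h3
  have hlt : (RankAgg.below ω (ω p) ∩ RankAgg.below (V j) (ω p)).card < n := by
    have h1 := Finset.card_le_card (Finset.inter_subset_left :
      RankAgg.below ω (ω p) ∩ RankAgg.below (V j) (ω p) ⊆ _)
    rw [RankAgg.card_below] at h1
    have := p.2
    omega
  have hf := hT₁.f _ hlt
  refine ⟨by simp [applyOps, Op.apply, e8, hT₁.size, add_mul], ?_⟩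
  simp [applyOps, Op.apply, e8, e20, r0, r2, r3, h₁, hT₁.vote, hT₁.weight, hf, RankAgg.posTerm]
  ring

theorem run_evalRanking (hT : Tables V β μ s) (hω : Holds 6 ω s) {i e : ℕ} (hie : i ≤ e)
    (hen : e ≤ n) (h5 : s.nat 5 = i) (h6 : s.nat 6 = e) :
    Run evalRanking s ((e - i) * (m * (n * 7 + 18) + 10) + 3) fun s' =>
      s'.real 0 = windowCost V β μ ω i e := by
  refine Run.le (T := 2 + ((e - i) * ((7 + ((m - 0) * ((n * 7 + 5 + 11) + 2) + 1)) + 2) + 1)) ?_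
    (by rw [Nat.sub_zero]; apply le_of_eq; ring)
  refine Run.seq (Q := fun s' => s'.nat 20 = i ∧ s'.real 0 = 0) (Run.ops le_rfl ?_)
    fun s₁ F₁ h₁ => ?_
  · simp [applyOps, Op.apply, h5, hT.zero]
  have hT₁ := hT.frame F₁
  refine Run.mono (Run.forLoop (fun k s' => s'.real 0 = windowCost V β μ ω i k) h₁.1
    ((F₁.nat 6 rfl).trans h6) hT₁.one hie ?_ ?_) le_rfl fun s' _ h => h
  · rw [h₁.2, windowCost, eq_comm]
    refine Finset.sum_eq_zero fun p hp => if_neg ?_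
    have := (Finset.mem_filter.1 hp).2
    omega
  · intro k s₂ hik hk h20 F₂ hI
    lift k to Fin n using lt_of_lt_of_le hk hen
    have hkn := k.2
    have hT₂ := hT₁.frame F₂
    have hω₂ := (hω.frame F₁).frame F₂
    refine Run.seq (Q := fun s' => s'.nat 7 = 0 ∧ s'.nat 8 = 0 ∧ s'.nat 24 = ω k ∧
      s'.real 2 = RankAgg.fBeta n β (n - (k + 1)) ∧ s'.real 3 = μ (ω k)) (Run.ops le_rfl ?_)
      fun s₃ F₃ h₃ => ?_
    · have hf := hT₂.f (n - (k + 1)) (by omega)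
      simp [applyOps, Op.apply, h20, hω₂ k, hT₂.size, hT₂.one, hT₂.weight, ← hf, Nat.sub_sub]
    have hT₃ := hT₂.frame F₃
    have hω₃ := hω₂.frame F₃
    have e20 : s₃.nat 20 = k := (F₃.nat 20 rfl).trans h20
    refine Run.mono (Run.forLoop (fun j s' => s'.nat 8 = j * n ∧ s'.real 0 = s₃.real 0 +
      ∑ j' ∈ Finset.univ.filter (fun j' : Fin m => (j' : ℕ) < j),
        RankAgg.posTerm β μ ω (V j') k) h₃.1 hT₃.voters hT₃.one (Nat.zero_le _) ?_ ?_) le_rfl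
      fun s' _ h => ?_
    · simp [h₃.2.1]
    · rintro j s₄ _ hj h7 F₄ ⟨h8, hsum⟩
      lift j to Fin m using hj
      refine Run.mono (run_addTerm (hT₃.frame F₄) (hω₃.frame F₄) h8 ((F₄.nat 20 rfl).trans e20)
        ((F₄.nat 24 rfl).trans h₃.2.2.1) ((F₄.real 2 rfl).trans h₃.2.2.2.1)
        ((F₄.real 3 rfl).trans h₃.2.2.2.2)) le_rfl fun s' _ h => ⟨?_, ?_⟩
      · simpa [Store.setNat] using h.1
      · rw [Store.setNat, h.2, hsum, sum_filter_val_lt_succ, add_assoc]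
    · have r0 : s₃.real 0 = s₂.real 0 := F₃.real 0 rfl
      rw [Store.setNat, h.2, r0, hI, windowCost, windowCost, sum_filter_val_lt_succ, if_pos hik]
      simp

end

end RealRAM

namespace RealRAM

/-! ## Enumeration of the rankings with a given beginning -/

/-- The ranking that is obtained from `ω` by exchanging, for `k = 0, 1, …`, the position `i + k` with
the position that is the `k`-th digit of `T` in base `n`, if this is larger. -/
def extension {n : ℕ} (ω : Equiv.Perm (Fin n)) (i T : ℕ) : ℕ → Equiv.Perm (Fin n)
  | 0 => ω
  | k + 1 =>
    if h : i + k < n ∧ i + k ≤ T / n ^ k % n then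
      extension ω i T k * Equiv.swap ⟨i + k, h.1⟩ ⟨T / n ^ k % n, Nat.mod_lt _ (by omega)⟩
    else extension ω i T k

theorem extension_agreeBelow {n : ℕ} (ω : Equiv.Perm (Fin n)) (i T k : ℕ) :
    RankAgg.AgreeBelow i (extension ω i T k) ω := by
  induction k with
  | zero => exact fun _ _ => rfl
  | succ k ih =>
    intro p hp
    rw [extension]
    split_ifs with h
    · rw [Equiv.Perm.mul_apply, Equiv.swap_apply_of_ne_of_ne, ih p hp]
      · intro h'
        rw [Fin.ext_iff] at h'
        simp only at h'
        omega
      · intro h'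
        rw [Fin.ext_iff] at h'
        simp only at h'
        omega
    · exact ih p hp

theorem extension_congr {n : ℕ} (ω : Equiv.Perm (Fin n)) (i : ℕ) {T T' : ℕ} {k : ℕ}
    (h : ∀ k' < k, T / n ^ k' % n = T' / n ^ k' % n) : extension ω i T k = extension ω i T' k := by
  induction k with
  | zero => rfl
  | succ k ih =>
    have h1 := h k (Nat.lt_succ_self k)
    simp only [extension, ih fun k' hk' => h k' (by omega), h1]

/-- The candidate wanted at position `i + k` currently sits at some `q ≥ i + k`, since the earlier
positions are already right; `q` becomes the new leading digit. Different `T` may give the same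
ranking, which is harmless for a minimum. -/
theorem exists_extension_agreeBelow {n : ℕ} {ω ω' : Equiv.Perm (Fin n)} {i : ℕ}
    (h : RankAgg.AgreeBelow i ω' ω) {k : ℕ} (hk : i + k ≤ n) :
    ∃ T < n ^ k, RankAgg.AgreeBelow (i + k) (extension ω i T k) ω' := by
  induction k with
  | zero => exact ⟨0, by simp, fun p hp => (h p hp).symm⟩
  | succ k ih =>
    obtain ⟨T, hT, hagree⟩ := ih (by omega)
    have hn : 0 < n := by omega
    set p : Fin n := ⟨i + k, by omega⟩ with hp
    set q : Fin n := (extension ω i T k).symm (ω' p) with hq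
    have hpos : 0 < n ^ k := Nat.pow_pos hn
    have hpq : i + k ≤ q := by
      by_contra hlt
      have h1 := hagree q (not_le.1 hlt)
      rw [hq, Equiv.apply_symm_apply] at h1
      have h2 := ω'.injective h1
      rw [← hq] at h2
      rw [← h2] at hlt
      exact hlt le_rfl
    have hdig : (q * n ^ k + T) / n ^ k % n = q := by
      rw [add_comm, Nat.add_mul_div_right _ _ hpos, Nat.div_eq_of_lt hT, zero_add,
        Nat.mod_eq_of_lt q.2]
    -- The added multiple of `n ^ k` leaves the digits below the `k`-th alone.
    have hlow : extension ω i (q * n ^ k + T) k = extension ω i T k := by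
      refine extension_congr ω i fun k' hk' => ?_
      obtain ⟨d, rfl⟩ : ∃ d, k = k' + 1 + d := ⟨k - (k' + 1), by omega⟩
      rw [show (q : ℕ) * n ^ (k' + 1 + d) + T = T + (q * n ^ d * n) * n ^ k' by ring,
        Nat.add_mul_div_right _ _ (Nat.pow_pos hn), Nat.add_mul_mod_self_right]
    refine ⟨q * n ^ k + T, ?_, fun r hr => ?_⟩
    · have : (q + 1) * n ^ k ≤ n * n ^ k := Nat.mul_le_mul_right _ q.2
      rw [pow_succ']
      linarith
    · rw [extension, dif_pos ⟨by omega, by rwa [hdig]⟩, hlow]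
      have e : (⟨(q * n ^ k + T) / n ^ k % n, Nat.mod_lt _ hn⟩ : Fin n) = q := Fin.ext hdig
      rw [e, Equiv.Perm.mul_apply]
      by_cases hrp : r = p
      · rw [hrp, Equiv.swap_apply_left, hq, Equiv.apply_symm_apply]
      · have hrp' := Fin.val_ne_of_ne hrp
        have hlt : (r : ℕ) < i + k := by
          simp only [hp] at hrp'
          omega
        rw [Equiv.swap_apply_of_ne_of_ne hrp, hagree r hlt]
        rintro rfl
        omega

/-- Store in the array `6` the ranking that is obtained from the one in the array `3` by exchanging
positions according to the digits in the array `5`. -/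
def buildRanking : Program :=
  .seq (copyArr 3 6) (.seq (ops (.natAdd 20 5 19) []) (forLoop 20 6
    (.seq (ops (.natLoad 24 5 20) [])
      (.ite (.natLt 24 20) (ops (.natConst 11 0) []) (swapCells 6 20 24)))))

/-- Increase the number whose digits in base `n` are in the array `5`; register `21` receives the
carry. -/
def nextDigits : Program :=
  .seq (ops (.natConst 21 1) [.natAdd 20 5 19]) (forLoop 20 6
    (.ite (.natLt 21 3) (ops (.natConst 11 0) [])
      (.seq (ops (.natLoad 11 5 20) [.natAdd 11 11 3]) (.ite (.natLt 11 0)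
        (ops (.natStore 5 20 11) [.natConst 21 0]) (ops (.natStore 5 20 19) [])))))

/-- Store the ranking in the array `6` and its truncated distance as the best ones so far. -/
def saveRanking : Program :=
  .seq (copyArr 6 1) (ops (.realConst 4 0) [.realAdd 1 0 4, .natConst 23 1])

/-- Try all exchanges of positions. -/
def search : Program :=
  .loop (.natLt 21 3) (.seq buildRanking (.seq evalRanking (.seq
    (.ite (.natLt 23 3) saveRanking
      (.ite (.realLt 0 1) saveRanking (ops (.natConst 11 0) []))) nextDigits)))

section

variable {n m : ℕ} {V : Fin m → Equiv.Perm (Fin n)} {β : ℕ → ℝ} {μ : Fin n → ℝ} {s : Store}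
  {ω : Equiv.Perm (Fin n)}

theorem run_buildRanking (hT : Tables V β μ s) (hω : Holds 3 ω s) {i e T : ℕ} (hie : i ≤ e)
    (hen : e ≤ n) (h5 : s.nat 5 = i) (h6 : s.nat 6 = e)
    (hdig : ∀ k < e - i, s.natArr 5 (i + k) = T / n ^ k % n) :
    Run buildRanking s (n * 4 + (e - i) * 8 + 4) (Holds 6 (extension ω i T (e - i))) := by
  refine Run.le (T := (n * 4 + 2) + (1 + ((e - i) * ((1 + (4 + 1)) + 2) + 1))) ?_ (by omega)
  refine Run.seq (run_copyArr (by decide) hT.size hT.one hω) fun s₁ F₁ h₁ => ?_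
  have hT₁ := hT.frame F₁
  refine Run.seq (Q := fun s' => s'.nat 20 = i ∧ Holds 6 ω s') (Run.ops le_rfl ?_)
    fun s₂ F₂ h₂ => ?_
  · refine ⟨?_, h₁.frame (frame_op (.natAdd 20 5 19) s₁)⟩
    simp [applyOps, Op.apply, F₁.nat 5 rfl, h5, hT₁.zero]
  have hT₂ := hT₁.frame F₂
  refine Run.mono (Run.forLoop (fun p s' => Holds 6 (extension ω i T (p - i)) s') h₂.1
    (by rw [F₂.nat 6 rfl, F₁.nat 6 rfl, h6]) hT₂.one hie ?_ ?_) le_rfl fun s' _ h => h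
  · rw [Nat.sub_self]
    exact h₂.2
  · intro p s₃ hip hp h20 F₃ hI
    have hpn := lt_of_lt_of_le hp hen
    obtain ⟨k, rfl⟩ := Nat.exists_eq_add_of_le hip
    rw [Nat.add_sub_cancel_left] at hI
    have hk : i + k + 1 - i = k + 1 := by omega
    rw [hk]
    have e5 : s₃.natArr 5 (i + k) = T / n ^ k % n := by
      rw [F₃.natArr 5 rfl, F₂.natArr 5 rfl, F₁.natArr 5 rfl, hdig k (by omega)]
    refine Run.seq (Q := fun s' => s'.nat 24 = T / n ^ k % n) (Run.ops le_rfl ?_) fun s₄ F₄ h₄ => ?_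
    · simp [applyOps, Op.apply, h20, e5]
    have e20 : s₄.nat 20 = i + k := (F₄.nat 20 rfl).trans h20
    have hI₄ := hI.frame F₄
    refine Run.ite (fun hlt => ?_) (fun hlt => ?_)
    · have hlt' : s₄.nat 24 < s₄.nat 20 := hlt
      rw [h₄, e20] at hlt'
      refine Run.ops (by simp) ?_
      rw [extension, dif_neg (by omega)]
      have hI₅ := hI₄.frame (frame_op (.natConst 11 0) s₄)
      exact hI₅
    · have hlt' : ¬ s₄.nat 24 < s₄.nat 20 := hlt
      rw [h₄, e20] at hlt'
      rw [extension, dif_pos ⟨hpn, by omega⟩]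
      exact run_swapCells hI₄ (p := ⟨i + k, hpn⟩) (q := ⟨T / n ^ k % n, Nat.mod_lt _ (by omega)⟩)
        e20 h₄

/-- Invariant: the cells before `p` hold digits of `T + 1`, the others digits of `T`, and the carry
is `1` iff `n ^ (p - i)` divides `T + 1`. -/
theorem run_nextDigits (hT : Tables V β μ s) {i e T : ℕ} (hie : i ≤ e) (hen : e ≤ n)
    (h5 : s.nat 5 = i) (h6 : s.nat 6 = e)
    (hdig : ∀ k < e - i, s.natArr 5 (i + k) = T / n ^ k % n) :
    Run nextDigits s ((e - i) * 8 + 3) fun s' =>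
      (∀ k < e - i, s'.natArr 5 (i + k) = (T + 1) / n ^ k % n) ∧
      s'.nat 21 = if n ^ (e - i) ∣ T + 1 then 1 else 0 := by
  refine Run.le (T := 2 + ((e - i) * (((2 + (2 + 1)) + 1) + 2) + 1)) ?_ (by omega)
  refine Run.seq (Q := fun s' => s'.nat 20 = i ∧ s'.nat 21 = 1) (Run.ops le_rfl ?_)
    fun s₁ F₁ h₁ => ?_
  · simp [applyOps, Op.apply, h5, hT.zero]
  have hT₁ := hT.frame F₁
  refine Run.mono (Run.forLoop (fun p s' =>
    (∀ k < e - i, s'.natArr 5 (i + k) = (if i + k < p then T + 1 else T) / n ^ k % n) ∧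
    s'.nat 21 = if n ^ (p - i) ∣ T + 1 then 1 else 0) h₁.1
    (by rw [F₁.nat 6 rfl, h6]) hT₁.one hie ?_ ?_) le_rfl
    fun s' _ h => ⟨fun k hk => ?_, h.2⟩
  · refine ⟨fun k hk => ?_, ?_⟩
    · rw [if_neg (by omega), F₁.natArr 5 rfl, hdig k hk]
    · rw [Nat.sub_self, pow_zero, if_pos (one_dvd _), h₁.2]
  · rintro p s₂ hip hp h20 F₂ ⟨hdig₂, hc⟩
    obtain ⟨k, rfl⟩ := Nat.exists_eq_add_of_le hip
    have hT₂ := hT₁.frame F₂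
    have hk : i + k + 1 - i = k + 1 := by omega
    rw [Nat.add_sub_cancel_left] at hc
    rw [hk]
    have hlt_iff (k' : ℕ) (hne : k' ≠ k) : i + k' < i + k + 1 ↔ i + k' < i + k := by omega
    have hn0 : 0 < n := by omega
    have hself := hdig₂ k (by omega)
    rw [if_neg (lt_irrefl _)] at hself
    have hdiv : (T + 1) / n ^ k = T / n ^ k + if n ^ k ∣ T + 1 then 1 else 0 := Nat.succ_div
    refine Run.ite (fun hlt => ?_) (fun hlt => ?_)
    · have hlt' : s₂.nat 21 < s₂.nat 3 := hlt
      rw [hT₂.one, hc] at hlt'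
      have hnd : ¬ n ^ k ∣ T + 1 := fun h => by rw [if_pos h] at hlt'; omega
      refine Run.ops (by simp) ⟨fun k' hk' => ?_, ?_⟩
      · have e5 : ((applyOps [.natConst 11 0] s₂).setNat 20 (i + k + 1)).natArr 5 (i + k') =
            s₂.natArr 5 (i + k') := rfl
        rw [e5, hdig₂ k' hk']
        by_cases hkk : k' = k
        · subst hkk
          rw [if_neg (by omega), if_pos (by omega), hdiv, if_neg hnd, add_zero]
        · simp only [hlt_iff k' hkk]
      · rw [if_neg fun h => hnd ((pow_dvd_pow n (Nat.le_succ k)).trans h)]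
        simp [applyOps, Op.apply, Store.setNat, hc, hnd]
    · have hlt' : ¬ s₂.nat 21 < s₂.nat 3 := hlt
      rw [hT₂.one, hc] at hlt'
      have hd : n ^ k ∣ T + 1 := by
        by_contra h
        rw [if_neg h] at hlt'
        omega
      rw [if_pos hd] at hdiv
      have hmod : (T / n ^ k + 1) % n = (T / n ^ k % n + 1) % n := by rw [Nat.mod_add_mod]
      -- The carry out of digit `k` survives exactly when that digit was `n - 1`.
      have hdvd : n ^ (k + 1) ∣ T + 1 ↔ n ∣ T / n ^ k + 1 := by
        obtain ⟨c, hc'⟩ := hd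
        have h0 := Nat.pow_pos (n := k) hn0
        have hcq : T / n ^ k + 1 = c := by rw [← hdiv, hc', Nat.mul_div_cancel_left _ h0]
        rw [hcq, hc', pow_succ, Nat.mul_dvd_mul_iff_left h0]
      refine Run.seq (Q := fun s' => s'.nat 11 = T / n ^ k % n + 1) (Run.ops le_rfl ?_)
        fun s₃ F₃ h₃ => ?_
      · simp [applyOps, Op.apply, h20, hself, hT₂.one]
      have hT₃ := hT₂.frame F₃
      have e20 : s₃.nat 20 = i + k := (F₃.nat 20 rfl).trans h20
      have hdig₃ : ∀ k' < e - i, k' ≠ k → s₃.natArr 5 (i + k') =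
          (if i + k' < i + k + 1 then T + 1 else T) / n ^ k' % n := fun k' hk' hne => by
        rw [F₃.natArr 5 rfl, hdig₂ k' hk']
        simp only [hlt_iff k' hne]
      have hif : (if i + k < i + k + 1 then T + 1 else T) = T + 1 := if_pos (by omega)
      refine Run.ite (fun hlt3 => ?_) (fun hlt3 => ?_)
      · have hlt3' : s₃.nat 11 < s₃.nat 0 := hlt3
        rw [h₃, hT₃.size] at hlt3'
        refine Run.ops le_rfl ⟨fun k' hk' => ?_, ?_⟩
        · by_cases hkk : k' = k
          · subst hkk
            rw [hif, hdiv, hmod, Nat.mod_eq_of_lt hlt3']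
            simp [applyOps, Op.apply, Store.setNat, e20, h₃]
          · rw [← hdig₃ k' hk' hkk]
            simp [applyOps, Op.apply, Store.setNat, e20, hkk]
        · have : ¬ n ∣ T / n ^ k + 1 := fun h => by
            have := Nat.mod_eq_zero_of_dvd h
            rw [hmod, Nat.mod_eq_of_lt hlt3'] at this
            omega
          rw [if_neg (mt hdvd.1 this)]
          simp [applyOps, Op.apply, Store.setNat]
      · have hlt3' : ¬ s₃.nat 11 < s₃.nat 0 := hlt3
        rw [h₃, hT₃.size] at hlt3'
        have hz : (T / n ^ k + 1) % n = 0 := by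
          have := Nat.mod_lt (T / n ^ k) hn0
          rw [hmod, show T / n ^ k % n + 1 = n by omega, Nat.mod_self]
        refine Run.ops (by simp) ⟨fun k' hk' => ?_, ?_⟩
        · by_cases hkk : k' = k
          · subst hkk
            rw [hif, hdiv, hz]
            simp [applyOps, Op.apply, Store.setNat, e20, hT₃.zero]
          · rw [← hdig₃ k' hk' hkk]
            simp [applyOps, Op.apply, Store.setNat, e20, hkk]
        · rw [if_pos (hdvd.2 (Nat.dvd_of_mod_eq_zero hz))]
          simp [applyOps, Op.apply, Store.setNat, F₃.nat 21 rfl, hc, hd]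
  · rw [h.1 k hk, if_pos (by omega)]

theorem run_saveRanking (hT : Tables V β μ s) (hω : Holds 6 ω s) :
    Run saveRanking s (n * 4 + 5) fun s' =>
      Holds 1 ω s' ∧ s'.real 1 = s.real 0 ∧ s'.nat 23 = 1 := by
  refine Run.le (T := (n * 4 + 2) + 3) ?_ (by omega)
  refine Run.seq (run_copyArr (by decide) hT.size hT.one hω) fun s₁ F₁ h₁ => Run.ops le_rfl ?_
  refine ⟨h₁, ?_, by simp [applyOps, Op.apply]⟩
  simp [applyOps, Op.apply, F₁.real 0 rfl]

end

end RealRAM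

/-! ### The whole program and its running time -/

namespace RealRAM

/-- Algorithm MyopicTop. -/
def myopicTop : Program :=
  .seq (ops (.natConst 3 1) []) (.seq voterPositions (.seq fTable (.seq initRanking
    (.seq majorityLoop (.seq (ops (.natAdd 6 5 2) []) (.seq
      (.ite (.natLt 6 0) (ops (.natConst 11 0) []) (ops (.natAdd 6 0 19) [])) search))))))

section

variable {n m : ℕ} {V : Fin m → Equiv.Perm (Fin n)} {β : ℕ → ℝ} {μ : Fin n → ℝ} {s : Store}
  {ω : Equiv.Perm (Fin n)}

/-- `T` is the number of extensions already tried, and the zeroed array `5` spells `T = 0`. Register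
`23` tells whether a cost has been saved yet, as no initial value larger than all costs is at hand.
-/
theorem run_search (hT : Tables V β μ s) (hω : Holds 3 ω s) {i e : ℕ} (hn : 0 < n) (hie : i ≤ e)
    (hen : e ≤ n) (h5 : s.nat 5 = i) (h6 : s.nat 6 = e) (hdig : ∀ k, s.natArr 5 k = 0)
    (h21 : s.nat 21 = 0) (h23 : s.nat 23 = 0) :
    Run search s (n ^ (e - i) * (n * 8 + (e - i) * 16 + (e - i) * (m * (n * 7 + 18) + 10) + 18) + 1)
      fun s' => ∃ T₀, Holds 1 (extension ω i T₀ (e - i)) s' ∧ ∀ T < n ^ (e - i),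
        windowCost V β μ (extension ω i T₀ (e - i)) i e ≤
          windowCost V β μ (extension ω i T (e - i)) i e := by
  set N := n ^ (e - i) with hN
  have hNpos : 0 < N := Nat.pow_pos hn
  set c : ℕ → ℝ := fun T => windowCost V β μ (extension ω i T (e - i)) i e with hc
  have key := Run.loop (b := .natLt 21 3) (P := .seq buildRanking (.seq evalRanking (.seq
    (.ite (.natLt 23 3) saveRanking
      (.ite (.realLt 0 1) saveRanking (ops (.natConst 11 0) []))) nextDigits)))
    (T := (n * 4 + (e - i) * 8 + 4) + (((e - i) * (m * (n * 7 + 18) + 10) + 3) +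
      (((n * 4 + 5) + 1 + 1) + ((e - i) * 8 + 3))))
    (Q := fun s' => ∃ T₀, Holds 1 (extension ω i T₀ (e - i)) s' ∧ ∀ T < N, c T₀ ≤ c T)
    (fun v s' => Tables V β μ s' ∧ Holds 3 ω s' ∧ s'.nat 5 = i ∧ s'.nat 6 = e ∧
      ∃ T, v = N - T ∧ T ≤ N ∧ s'.nat 21 = (if T = N then 1 else 0) ∧
        (∀ k < e - i, s'.natArr 5 (i + k) = T / n ^ k % n) ∧
        (T = 0 ∧ s'.nat 23 = 0 ∨ s'.nat 23 = 1 ∧ ∃ T₀, Holds 1 (extension ω i T₀ (e - i)) s' ∧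
          s'.real 1 = c T₀ ∧ ∀ T' < T, c T₀ ≤ c T'))
    ?_ ?_ N s ⟨hT, hω, h5, h6, 0, rfl, Nat.zero_le _, ?_, ?_, Or.inl ⟨rfl, h23⟩⟩
  · refine key.le ?_
    apply le_of_eq
    ring
  · rintro v s₁ ⟨hT₁, hω₁, h5₁, h6₁, T, rfl, hTN, hcarry, hdig₁, hbest⟩ hlt
    have hlt' : s₁.nat 21 < s₁.nat 3 := hlt
    rw [hcarry, hT₁.one] at hlt'
    have hTlt : T < N := by
      rcases hTN.lt_or_eq with h | h
      · exact h
      · rw [if_pos h] at hlt'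
        omega
    refine Run.seq (run_buildRanking hT₁ hω₁ hie hen h5₁ h6₁ hdig₁) fun s₂ F₂ h₂ => ?_
    have hT₂ := hT₁.frame F₂
    refine Run.seq (run_evalRanking hT₂ h₂ hie hen ((F₂.nat 5 rfl).trans h5₁)
      ((F₂.nat 6 rfl).trans h6₁)) fun s₃ F₃ h₃ => ?_
    have hT₃ := hT₂.frame F₃
    have hw₃ := h₂.frame F₃
    have h23₃ : s₃.nat 23 = s₁.nat 23 := (F₃.nat 23 rfl).trans (F₂.nat 23 rfl)
    have r1₃ : s₃.real 1 = s₁.real 1 := (F₃.real 1 rfl).trans (F₂.real 1 rfl)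
    refine Run.seq (Q := fun s' => s'.nat 23 = 1 ∧ ∃ T₀, Holds 1 (extension ω i T₀ (e - i)) s' ∧
      s'.real 1 = c T₀ ∧ ∀ T' < T + 1, c T₀ ≤ c T') ?_ fun s₄ F₄ h₄ => ?_
    · refine Run.ite (fun hfirst => ?_) (fun hfirst => Run.ite (fun hless => ?_) fun hless => ?_)
      · have hfirst' : s₃.nat 23 < s₃.nat 3 := hfirst
        rw [h23₃, hT₃.one] at hfirst'
        rcases hbest with ⟨rfl, _⟩ | ⟨h, _⟩
        · refine (run_saveRanking hT₃ hw₃).mono (by omega) fun s' _ h =>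
            ⟨h.2.2, 0, h.1, h.2.1.trans h₃, fun T' hT' => ?_⟩
          rw [Nat.lt_one_iff.1 hT']
        · omega
      · have hfirst' : ¬ s₃.nat 23 < s₃.nat 3 := hfirst
        rw [h23₃, hT₃.one] at hfirst'
        have hless' : s₃.real 0 < s₃.real 1 := hless
        rcases hbest with ⟨_, h⟩ | ⟨_, T₀, hT₀, hr, hmin⟩
        · omega
        · rw [h₃, r1₃, hr] at hless'
          refine (run_saveRanking hT₃ hw₃).mono le_rfl fun s' _ h =>
            ⟨h.2.2, T, h.1, h.2.1.trans h₃, fun T' hT' => ?_⟩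
          rcases Nat.lt_succ_iff_lt_or_eq.1 hT' with h' | h'
          · exact hless'.le.trans (hmin T' h')
          · rw [h']
      · have hfirst' : ¬ s₃.nat 23 < s₃.nat 3 := hfirst
        rw [h23₃, hT₃.one] at hfirst'
        have hless' : ¬ s₃.real 0 < s₃.real 1 := hless
        rcases hbest with ⟨_, h⟩ | ⟨h23₁, T₀, hT₀, hr, hmin⟩
        · omega
        · rw [h₃, r1₃, hr, not_lt] at hless'
          have hT₀' := ((hT₀.frame F₂).frame F₃).frame (frame_op (.natConst 11 0) s₃)
          refine Run.ops (by simp) ⟨?_, T₀, hT₀', r1₃.trans hr, fun T' hT' => ?_⟩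
          · simp [applyOps, Op.apply, h23₃, h23₁]
          · rcases Nat.lt_succ_iff_lt_or_eq.1 hT' with h' | h'
            · exact hmin T' h'
            · rw [h']
              exact hless'
    · have hT₄ := hT₃.frame F₄
      have e5 : s₄.nat 5 = i := by rw [F₄.nat 5 rfl, F₃.nat 5 rfl, F₂.nat 5 rfl, h5₁]
      have e6 : s₄.nat 6 = e := by rw [F₄.nat 6 rfl, F₃.nat 6 rfl, F₂.nat 6 rfl, h6₁]
      have edig : s₄.natArr 5 = s₁.natArr 5 := by
        rw [F₄.natArr 5 rfl, F₃.natArr 5 rfl, F₂.natArr 5 rfl]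
      refine (run_nextDigits hT₄ hie hen e5 e6 (T := T) (by rwa [edig])).mono le_rfl
        fun s₅ F₅ h₅ => ⟨_, ?_, hT₄.frame F₅, (((hω₁.frame F₂).frame F₃).frame F₄).frame F₅,
          (F₅.nat 5 rfl).trans e5, (F₅.nat 6 rfl).trans e6, T + 1, rfl, hTlt, ?_, h₅.1,
          Or.inr ⟨(F₅.nat 23 rfl).trans h₄.1, ?_⟩⟩
      · omega
      · rw [h₅.2, ← hN]
        -- As `T < N`, the final carry appears exactly when the enumeration is complete.
        have : N ∣ T + 1 ↔ T + 1 = N :=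
          ⟨fun h => le_antisymm hTlt (Nat.le_of_dvd (Nat.succ_pos _) h), fun h => h ▸ dvd_rfl⟩
        simp only [this]
      · obtain ⟨T₀, hT₀, hr, hmin⟩ := h₄.2
        exact ⟨T₀, hT₀.frame F₅, (F₅.real 1 rfl).trans hr, hmin⟩
  · rintro v s₁ ⟨hT₁, hω₁, h5₁, h6₁, T, rfl, hTN, hcarry, hdig₁, hbest⟩ hlt
    have hlt' : ¬ s₁.nat 21 < s₁.nat 3 := hlt
    rw [hcarry, hT₁.one] at hlt'
    have hTN' : T = N := by
      by_contra h
      rw [if_neg h] at hlt'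
      omega
    subst hTN'
    rcases hbest with ⟨h, _⟩ | ⟨_, T₀, hT₀, _, hmin⟩
    · omega
    · exact ⟨T₀, hT₀, hmin⟩
  · rw [if_neg (by omega), h21]
  · intro k _
    rw [hdig, Nat.zero_div, Nat.zero_mod]

end

/-- Every competitor agrees with some enumerated extension up to the end of the window, and the
truncated cost depends on these positions only. -/
theorem isMyopicTopOutput_extension {n m K : ℕ} {V : Fin m → Equiv.Perm (Fin n)} {β : ℕ → ℝ}
    {μ : Fin n → ℝ} {ω : Equiv.Perm (Fin n)} {i T₀ : ℕ} (hi : i ≤ n)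
    (hl : RankAgg.LoopReaches V (RankAgg.placed ω i) (RankAgg.remaining ω i))
    (hno : ¬ ∃ c, RankAgg.IsMajority V (RankAgg.remaining ω i) c)
    (hmin : ∀ T < n ^ min K (n - i),
      windowCost V β μ (extension ω i T₀ (min K (n - i))) i (i + min K (n - i)) ≤
        windowCost V β μ (extension ω i T (min K (n - i))) i (i + min K (n - i))) :
    RankAgg.IsMyopicTopOutput K V β μ (extension ω i T₀ (min K (n - i))) := by
  have hcard : (RankAgg.remaining ω i).card = n - i := by
    rw [hl.card_eq ((RankAgg.startsWith_placed_iff hi).2 fun _ _ => rfl),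
      RankAgg.length_placed ω hi]
  refine ⟨_, _, hl, hno, (RankAgg.startsWith_placed_iff hi).2 (extension_agreeBelow ω i T₀ _),
    fun ω' hω' => ?_⟩
  rw [RankAgg.length_placed ω hi, hcard, ← windowCost_eq]
  obtain ⟨T, hT, hagree⟩ := exists_extension_agreeBelow
    ((RankAgg.startsWith_placed_iff hi).1 hω') (k := min K (n - i)) (by omega)
  refine (hmin T hT).trans (le_of_eq ?_)
  rw [windowCost_eq]
  exact Finset.sum_congr rfl fun j _ => hagree.truncDist_eq β μ (V j)

/-- The search dominates with `n ^ K` rounds of order `n * m * K`. The majority phase, of order `n *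
n * m`, is absorbed because `n ≤ n ^ K`. -/
theorem myopicTop_time_le {n m K : ℕ} (hn : 1 ≤ n) (hm : 1 ≤ m) (hK : 1 ≤ K) :
    1 + ((m * (n * 6 + 5) + 3) + ((n * (n * 7 + 6) + 2) + ((n * 3 + 4) +
      ((n * (n * 9 + m * (n * 10 + 9) + 15) + 1) + (1 + (2 +
      (n ^ K * (n * 8 + K * 16 + K * (m * (n * 7 + 18) + 10) + 18) + 1))))))) ≤
      200 * (n ^ (K + 1) * m * K) := by
  have hP : n ≤ n ^ K := Nat.le_self_pow (by omega) n
  have e : n ^ (K + 1) * m * K = n ^ K * (n * m * K) := by ring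
  rw [e]
  generalize n ^ K = P at *
  set Y := n * m * K with hY
  have y1 : n * m ≤ Y := Nat.le_mul_of_pos_right _ hK
  have y2 : n ≤ n * m := Nat.le_mul_of_pos_right _ hm
  have y3 : m ≤ n * m := Nat.le_mul_of_pos_left _ hn
  have y4 : K * m * n = Y := by rw [hY]; ring
  have y5 : K * m ≤ K * m * n := Nat.le_mul_of_pos_right _ hn
  have y6 : K ≤ K * m := Nat.le_mul_of_pos_right _ hm
  -- Each monomial is at most `Y`, and the coefficients add up to `77`.
  have hB : n * 8 + K * 16 + K * (m * (n * 7 + 18) + 10) + 18 ≤ 80 * Y := by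
    have : K * (m * (n * 7 + 18) + 10) = 7 * (K * m * n) + 18 * (K * m) + 10 * K := by ring
    omega
  have h1 : P * (n * 8 + K * 16 + K * (m * (n * 7 + 18) + 10) + 18) ≤ P * (80 * Y) :=
    Nat.mul_le_mul_left _ hB
  have h2 : n * (n * m) ≤ P * Y := Nat.mul_le_mul hP y1
  have h3 : n * n ≤ n * (n * m) := Nat.mul_le_mul_left _ y2
  have h4 : n * m ≤ n * (n * m) := Nat.le_mul_of_pos_left _ hn
  have e1 : P * (80 * Y) = 80 * (P * Y) := by ring
  have e2 : m * (n * 6 + 5) = 6 * (n * m) + 5 * m := by ring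
  have e3 : n * (n * 7 + 6) = 7 * (n * n) + 6 * n := by ring
  have e4 : n * (n * 9 + m * (n * 10 + 9) + 15) =
      9 * (n * n) + 10 * (n * (n * m)) + 9 * (n * m) + 15 * n := by ring
  omega

theorem run_myopicTop {n m K : ℕ} (hn : 2 ≤ n) (hm : 1 ≤ m) (hK : 1 ≤ K)
    (V : Fin m → Equiv.Perm (Fin n)) (β : ℕ → ℝ) (μ : Fin n → ℝ) :
    ∃ t ≤ 200 * (n ^ (K + 1) * m * K), RunsMyopicTop myopicTop K V β μ t := by
  suffices h : Run myopicTop (inputStore K V β μ) (200 * (n ^ (K + 1) * m * K)) fun s' =>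
      ∃ ω : Equiv.Perm (Fin n), Holds 1 ω s' ∧ RankAgg.IsMyopicTopOutput K V β μ ω by
    obtain ⟨s', t, he, ht, ω, h1, h2⟩ := h
    exact ⟨t, ht, s', ω, he, h1, h2⟩
  set s := inputStore K V β μ with hs
  have hV : ∀ (j : Fin m) (p : Fin n), s.natArr 0 (j * n + p) = V j p := fun j p => by
    have hn0 : 0 < n := by omega
    have h1 : (j * n + p : ℕ) / n = j := by
      rw [mul_comm, Nat.mul_add_div hn0, Nat.div_eq_of_lt p.2, add_zero]
    have h2 : (j * n + p : ℕ) % n = p := by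
      rw [Nat.mul_add_mod_self_right, Nat.mod_eq_of_lt p.2]
    simp [hs, inputStore, h1, h2]
  refine Run.le ?_ (myopicTop_time_le (by omega) hm hK)
  have hn0 : s.nat 0 = n := rfl
  have hm0 : s.nat 1 = m := rfl
  refine Run.seq (Q := fun s' => s'.nat 3 = 1) (Run.ops le_rfl ?_) fun s₁ F₁ h₁ => ?_
  · simp [applyOps, Op.apply]
  refine Run.seq (run_voterPositions (V := V) ((F₁.nat 0 rfl).trans hn0)
    ((F₁.nat 1 rfl).trans hm0) h₁ (by rw [F₁.natArr 0 rfl]; exact hV)) fun s₂ F₂ h₂ => ?_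
  have eβ : s₂.realArr 0 = s.realArr 0 := (F₂.realArr 0 rfl).trans (F₁.realArr 0 rfl)
  refine Run.seq (run_fTable (β := β) hn (by rw [F₂.nat 0 rfl, F₁.nat 0 rfl, hn0])
    ((F₂.nat 3 rfl).trans h₁) (by rw [eβ]; simp [hs, inputStore])
    (fun k hk hk' => by rw [eβ]; simp [hs, inputStore, hk, hk'])) fun s₃ F₃ h₃ => ?_
  have hT : Tables V β μ s₃ := by
    refine ⟨?_, ?_, ?_, ?_, ?_, ?_, ?_, h₃⟩
    · rw [F₃.nat 0 rfl, F₂.nat 0 rfl, F₁.nat 0 rfl, hn0]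
    · rw [F₃.nat 1 rfl, F₂.nat 1 rfl, F₁.nat 1 rfl, hm0]
    · rw [F₃.nat 3 rfl, F₂.nat 3 rfl, h₁]
    · rw [F₃.nat 19 rfl, F₂.nat 19 rfl, F₁.nat 19 rfl]
      rfl
    · rw [F₃.natArr 0 rfl, F₂.natArr 0 rfl, F₁.natArr 0 rfl]
      exact hV
    · rw [F₃.natArr 2 rfl]
      exact h₂
    · rw [F₃.realArr 1 rfl, F₂.realArr 1 rfl, F₁.realArr 1 rfl]
      intro x
      simp [hs, inputStore]
  refine Run.seq (run_initRanking hT) fun s₄ F₄ h₄ => ?_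
  have hT₄ := hT.frame F₄
  refine Run.seq (run_majorityLoop hT₄ h₄.1 h₄.2.1 h₄.2.2) ?_
  rintro s₅ F₅ ⟨ω, i, hω, h5, hi, hl, hno⟩
  have hT₅ := hT₄.frame F₅
  have e2 : s₅.nat 2 = K := by
    rw [F₅.nat 2 rfl, F₄.nat 2 rfl, F₃.nat 2 rfl, F₂.nat 2 rfl, F₁.nat 2 rfl]
    rfl
  refine Run.seq (Q := fun s' => s'.nat 6 = i + K) (Run.ops le_rfl ?_) fun s₆ F₆ h₆ => ?_
  · simp [applyOps, Op.apply, h5, e2]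
  have hT₆ := hT₅.frame F₆
  -- Capping `i + K` at `n` replaces `K` by its minimum with `|Q| = n - i`.
  refine Run.seq (T := 2) (Q := fun s' => s'.nat 6 = i + min K (n - i)) (Run.ite (T := 1)
    (fun hlt => ?_) (fun hlt => ?_)) fun s₇ F₇ h₇ => ?_
  · have hlt' : s₆.nat 6 < s₆.nat 0 := hlt
    rw [h₆, hT₆.size] at hlt'
    refine Run.ops le_rfl ?_
    have : (applyOps [.natConst 11 0] s₆).nat 6 = i + K := by simp [applyOps, Op.apply, h₆]
    rw [this]
    omega
  · have hlt' : ¬ s₆.nat 6 < s₆.nat 0 := hlt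
    rw [h₆, hT₆.size] at hlt'
    refine Run.ops le_rfl ?_
    have : (applyOps [.natAdd 6 0 19] s₆).nat 6 = n := by
      simp [applyOps, Op.apply, hT₆.size, hT₆.zero]
    rw [this]
    omega
  have hT₇ := hT₆.frame F₇
  have hrun := run_search hT₇ ((hω.frame F₆).frame F₇) (i := i) (e := i + min K (n - i))
    (by omega) (by omega) (by omega) (by rw [F₇.nat 5 rfl, F₆.nat 5 rfl, h5]) h₇ ?_ ?_ ?_
  · rw [Nat.add_sub_cancel_left] at hrun
    refine hrun.mono ?_ ?_
    · have h1 : min K (n - i) ≤ K := min_le_left _ _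
      have h2 : 0 < n := by omega
      gcongr
    · rintro s' - ⟨T₀, hT₀, hmin⟩
      exact ⟨_, hT₀, isMyopicTopOutput_extension hi hl hno hmin⟩
  · rw [F₇.natArr 5 rfl, F₆.natArr 5 rfl, F₅.natArr 5 rfl, F₄.natArr 5 rfl, F₃.natArr 5 rfl,
      F₂.natArr 5 rfl, F₁.natArr 5 rfl]
    exact fun _ => rfl
  · rw [F₇.nat 21 rfl, F₆.nat 21 rfl, F₅.nat 21 rfl, F₄.nat 21 rfl, F₃.nat 21 rfl,
      F₂.nat 21 rfl, F₁.nat 21 rfl]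
    rfl
  · rw [F₇.nat 23 rfl, F₆.nat 23 rfl, F₅.nat 23 rfl, F₄.nat 23 rfl, F₃.nat 23 rfl,
      F₂.nat 23 rfl, F₁.nat 23 rfl]
    rfl

end RealRAM

/-! ### The approximation guarantee and the running time together -/

theorem mainTheorem7 :
    ∃ (P : RealRAM.Program) (C : ℕ),
      RealRAM.ImplementsMyopicTop P ∧
      ∀ (β : ℕ → ℝ),
        (∀ k, 2 ≤ k → 0 ≤ β k) → 0 < β 2 →
        Tendsto (RankAgg.growthSup β) atTop (𝓝 0) →
      ∀ (μ : (k : ℕ) → Fin k → ℝ) (u U : ℝ),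
        0 < u → (∀ k, 2 ≤ k → ∀ i, u ≤ μ k i ∧ μ k i ≤ U) →
      ∀ (ε : ℝ), 0 < ε →
      ∀ (K : ℕ), K = RankAgg.depth β (12 * U / (u * ε)) →
        K ∈ RankAgg.depthSet β (u * ε / (12 * U)) ∧
        ∀ (n m : ℕ), 2 ≤ n → 1 ≤ m → ∀ (V : Fin m → Equiv.Perm (Fin n)),
          (∀ σapx σstar : Equiv.Perm (Fin n),
            RankAgg.IsMyopicTopOutput K V β (μ n) σapx →
            RankAgg.IsConsensus β (μ n) V σstar →
            RankAgg.profileDist β (μ n) σapx V ≤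
              (1 + ε) * RankAgg.profileDist β (μ n) σstar V) ∧
          ∃ t : ℕ, t ≤ C * (n ^ (K + 1) * m * K) ∧
            RealRAM.RunsMyopicTop P K V β (μ n) t := by
  refine ⟨RealRAM.myopicTop, 200, ?_, ?_⟩
  · intro n m K V β μ hn hm hK _ _
    obtain ⟨t, _, h⟩ := RealRAM.run_myopicTop hn hm hK V β μ
    exact ⟨t, h⟩
  · intro β hβ hβ2 hlim μ u U hu hμ ε hε K hK
    -- Some weight has to be inspected to see that `U` is positive; the measure on two candidates
    -- provides one.
    have h2 := hμ 2 le_rfl 0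
    have hU : 0 < U := hu.trans_le (h2.1.trans h2.2)
    have hmem : K ∈ RankAgg.depthSet β (u * ε / (12 * U)) := by
      rw [hK, RankAgg.depth, one_div_div]
      exact RankAgg.depth_mem_depthSet hlim (by positivity)
    refine ⟨hmem, fun n m hn hm V => ⟨fun σapx σstar hσ _ => ?_, ?_⟩⟩
    · exact hσ.profileDist_le hβ hβ2 hu hU hε (hμ n hn) hmem.2 σstar
    · obtain ⟨t, ht, h⟩ := RealRAM.run_myopicTop hn hm hmem.1 V β (μ n)
      exact ⟨t, ht, h⟩
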